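/- **Setting (knapsack with Bursty Adversary plus Random Order).** Let $n\in\mathbb N$ be the number of time steps and $k$ the (real) knapsack size, with $80\le k\le n/2$; let the window size $\ell\in\mathbb N$ be $\frac{n\ln k}{k}$ up to rounding, i.e. $|\ell-\frac{n\ln k}{k}|<1$; and let $\Gamma\in\mathbb N$ with $\Gamma\ge\sqrt k$. The times $[n]=\{1,\dots,n\}$ are partitioned into the consecutive windows $\{1,\dots,\ell\},\{\ell+1,\dots,2\ell\},\dots$ (the last one possibly truncated). The adversary fixes a set $Adv\subseteq[n]$, a family of at most $\Gamma$ windows (the adversarial windows) covering $Adv$, and, with $RO=[n]\setminus Adv$, items $(v_i,w_i)$, $i=1,\dots,|RO|$, with $v_i>0$, $w_i\in(0,1]$ and pairwise different densities $v_i/w_i$. A uniformly random bijection $t\mapsto I_t$ from $RO$ to $\{1,\dots,|RO|\}$ is drawn. At a time $t\in RO$ the item with value $V_t=v_{I_t}$ and size $W_t=w_{I_t}$ arrives; at a time $t\in Adv$ an arbitrary item with $V_t\ge0$, $W_t\in[0,1]$ arrives, which may depend on the algorithm and on the whole bijection. A time is *free* if it lies in no adversarial window (so it is in $RO$). **Algorithm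 with parameter $a_4$.** At time $t$ the algorithm takes an arbitrary optimal solution $X^t$ of the linear program: maximize $\sum_{s\le t}V_sX_s$ over $X\in[0,1]^t$ subject to $\sum_{s\le t}W_sX_s\le\big(1-\frac{4\Gamma\ell}{t}\big)\frac tn k$ and $\sum_{s\in B\cap[t]}W_sX_s\le 601\,\frac{\ell}{n}k$ for every window $B$ (if the program is infeasible, $X^t$ is arbitrary). The item of time $t$ is tentatively picked if $X^t_t>0$. Let $F_t=1$ if $$\sum_{s\in B_t,\ s<t}W_sX^{alg}_s\le a_4\frac{\ell}{n}k-1\qquad\text{and}\qquad\sum_{s<t}W_sX^{alg}_s\le k-1,$$ where $B_t$ is the window containing $t$; otherwise $F_t=0$, and the algorithm is *blocked* at time $t$. The algorithm sets $X^{alg}_t=1$ if the item of time $t$ is tentatively picked and $F_t=1$, and $X^{alg}_t=0$ otherwise. **Theorem (probability of being blocked).** For every sufficiently large constant $a_4$ there are constants $a_5,C>0$, depending only on $a_4$, such that in every instance as above, for every free time $t\ge 8\ell(\Gamma+2)$ with $1-\frac tn-a_5\frac{\Gamma\ln k}{k}>0$ and every item index $i\in\{1,\dots,|RO|\}$, $$\Pr\big(F_t=0\mid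 I_t=i\big)\le\frac{C}{k\left(1-\frac tn-a_5\frac{\Gamma\ln k}{k}\right)^2}.$$ -/

import Mathlib

/-- The `b`-th window (`b = 0, 1, 2, …`) of length `ℓ`: the times `bℓ + 1, …, (b + 1)ℓ`.
Times are numbered from `1`. -/
def baroWindow (ℓ b : ℕ) : Finset ℕ := Finset.Icc (b * ℓ + 1) ((b + 1) * ℓ)

/-- The last window `{⌊s/ℓ⌋ℓ + 1, …, s}`, with `s = t - 1`, of the windows truncated to `[t - 1]`.
It consists of the times before `t` in the window of `t`, and is empty if `t` opens a window. -/
def baroLast (ℓ t : ℕ) : Finset ℕ := Finset.Icc ((t - 1) / ℓ * ℓ + 1) (t - 1)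

/-- What the adversary fixes in advance in the BARO knapsack model. -/
structure BaroInstance where
  /-- number of time steps -/
  n : ℕ
  /-- knapsack size -/
  k : ℝ
  /-- window size, `n ln k / k` up to rounding -/
  ℓ : ℕ
  /-- bound on the number of adversarial windows -/
  Γ : ℕ
  /-- adversarial times -/
  adv : Finset ℕ
  /-- (indices of) the windows that cover the adversarial times -/
  advWindows : Finset ℕ
  /-- values of the random-order items -/
  v : Fin (Finset.Icc 1 n \ adv).card → ℝ
  /-- sizes of the random-order items -/
  w : Fin (Finset.Icc 1 n \ adv).card → ℝ
  k_ge : 80 ≤ k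
  k_le : k ≤ (n : ℝ) / 2
  ℓ_eq : |(ℓ : ℝ) - n * Real.log k / k| < 1
  Γ_ge : Real.sqrt k ≤ Γ
  adv_subset : adv ⊆ Finset.Icc 1 n
  advWindows_card : advWindows.card ≤ Γ
  adv_covered : ∀ t ∈ adv, ∃ b ∈ advWindows, t ∈ baroWindow ℓ b
  v_pos : ∀ i, 0 < v i
  w_pos : ∀ i, 0 < w i
  w_le_one : ∀ i, w i ≤ 1
  /-- no ties among the value densities -/
  density_injective : Function.Injective fun i => v i / w i

namespace BaroInstance

/-- The random-order times. -/
abbrev ro (M : BaroInstance) : Finset ℕ := Finset.Icc 1 M.n \ M.adv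

/-- A time is free if it lies in none of the adversarial windows. -/
def IsFree (M : BaroInstance) (t : ℕ) : Prop :=
  t ∈ Finset.Icc 1 M.n ∧ ∀ b ∈ M.advWindows, t ∉ baroWindow M.ℓ b

theorem IsFree.mem_ro {M : BaroInstance} {t : ℕ} (h : M.IsFree t) : t ∈ M.ro := by
  refine Finset.mem_sdiff.2 ⟨h.1, fun ha => ?_⟩
  obtain ⟨b, hb, htb⟩ := M.adv_covered t ha
  exact h.2 b hb htb

/-- The budget scaling `c_t = 1 - 4Γℓ/t`. -/
noncomputable def scale (M : BaroInstance) (t : ℕ) : ℝ := 1 - 4 * M.Γ * M.ℓ / t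

/-- Feasibility for the linear program of time `t`, for the item sizes `W`. Only the coordinates
`x 1, …, x t` matter. The windows truncated to `[t]` are indexed by all `b`; those that are empty
give trivial constraints. -/
def LPFeasible (M : BaroInstance) (W : ℕ → ℝ) (t : ℕ) (x : ℕ → ℝ) : Prop :=
  ∑ s ∈ Finset.Icc 1 t, W s * x s ≤ M.scale t * (t / M.n) * M.k ∧
  (∀ b, ∑ s ∈ baroWindow M.ℓ b ∩ Finset.Icc 1 t, W s * x s ≤ 601 * (M.ℓ / M.n) * M.k) ∧
  ∀ s ∈ Finset.Icc 1 t, 0 ≤ x s ∧ x s ≤ 1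

/-- Optimality for the linear program of time `t`, for the item values `V` and sizes `W`. -/
def LPOptimal (M : BaroInstance) (V W : ℕ → ℝ) (t : ℕ) (x : ℕ → ℝ) : Prop :=
  M.LPFeasible W t x ∧ ∀ y, M.LPFeasible W t y →
    ∑ s ∈ Finset.Icc 1 t, V s * y s ≤ ∑ s ∈ Finset.Icc 1 t, V s * x s

/-- The outer constraint and the main budget, which the earlier selections `x 1, …, x (t - 1)` have
to satisfy in order that the item of time `t` may be picked. -/
def Unblocked (M : BaroInstance) (a₄ : ℝ) (W : ℕ → ℝ) (x : ℕ → ℝ) (t : ℕ) : Prop :=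
  ∑ s ∈ baroLast M.ℓ t, W s * x s ≤ a₄ * (M.ℓ / M.n) * M.k - 1 ∧
  ∑ s ∈ Finset.Ico 1 t, W s * x s ≤ M.k - 1

open Classical in
/-- The selections of the algorithm up to time `t` (and `0` for later times), given the item sizes
`W` and the solutions `X t` of the linear programs. -/
noncomputable def selUpTo (M : BaroInstance) (a₄ : ℝ) (W : ℕ → ℝ) (X : ℕ → ℕ → ℝ) : ℕ → ℕ → ℝ
  | 0 => 0
  | t + 1 => Function.update (selUpTo M a₄ W X t) (t + 1)
      (if 0 < X (t + 1) (t + 1) ∧ M.Unblocked a₄ W (selUpTo M a₄ W X t) (t + 1) then 1 else 0)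

/-- The selection of the algorithm at time `t`. -/
noncomputable def xalg (M : BaroInstance) (a₄ : ℝ) (W : ℕ → ℝ) (X : ℕ → ℕ → ℝ) (t : ℕ) : ℝ :=
  M.selUpTo a₄ W X t t

theorem selUpTo_eq_xalg (M : BaroInstance) (a₄ : ℝ) (W : ℕ → ℝ) (X : ℕ → ℕ → ℝ) {s t : ℕ}
    (h : s ≤ t) : M.selUpTo a₄ W X t s = M.xalg a₄ W X s := by
  induction t with
  | zero => rw [Nat.le_zero.1 h]; rfl
  | succ t ih =>
    rcases Nat.lt_or_ge t s with h' | h'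
    · rw [show s = t + 1 by omega]; rfl
    · rw [← ih h', selUpTo, Function.update_of_ne (by omega)]

open Classical in
/-- The item of time `t` is picked exactly if it is tentatively picked and not blocked. -/
theorem xalg_eq (M : BaroInstance) (a₄ : ℝ) (W : ℕ → ℝ) (X : ℕ → ℕ → ℝ) {t : ℕ} (ht : 1 ≤ t) :
    M.xalg a₄ W X t =
      if 0 < X t t ∧ M.Unblocked a₄ W (M.xalg a₄ W X) t then 1 else 0 := by
  obtain ⟨t, rfl⟩ : ∃ u, t = u + 1 := ⟨t - 1, by omega⟩
  have key : M.Unblocked a₄ W (M.selUpTo a₄ W X t) (t + 1) ↔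
      M.Unblocked a₄ W (M.xalg a₄ W X) (t + 1) := by
    unfold Unblocked
    rw [Finset.sum_congr rfl (fun s hs => by
        rw [selUpTo_eq_xalg M a₄ W X (by simp [baroLast] at hs; omega)]),
      Finset.sum_congr (s₁ := Finset.Ico 1 (t + 1)) rfl (fun s hs => by
        rw [selUpTo_eq_xalg M a₄ W X (by simp at hs; omega)])]
  rw [xalg, selUpTo, Function.update_self, key]

end BaroInstance

/-- A random run of the BARO model together with the solutions of the linear programs that the
algorithm uses. The items at the adversarial times are arbitrary random variables: they may depend
on the whole order of the random-order items, on the behaviour of the algorithm and on further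
randomness. -/
structure BaroRun (M : BaroInstance) {Ω : Type*} [MeasurableSpace Ω]
    (P : MeasureTheory.Measure Ω) where
  /-- the random-order items in their random order: `I ω t` is the item that appears at time `t` -/
  I : Ω → (M.ro ≃ Fin M.ro.card)
  /-- `V ω t` is the value of the item of time `t` -/
  V : Ω → ℕ → ℝ
  /-- `W ω t` is the size of the item of time `t` -/
  W : Ω → ℕ → ℝ
  /-- `X ω t` is the solution of the linear program of time `t` that the algorithm finds -/
  X : Ω → ℕ → ℕ → ℝ
  I_measurable : ∀ σ, MeasurableSet {ω | I ω = σ}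
  I_uniform : ∀ σ, P.real {ω | I ω = σ} = 1 / (M.ro.card.factorial : ℝ)
  V_measurable : ∀ t, Measurable fun ω => V ω t
  W_measurable : ∀ t, Measurable fun ω => W ω t
  X_measurable : ∀ t s, Measurable fun ω => X ω t s
  V_nonneg : ∀ ω, ∀ t ∈ Finset.Icc 1 M.n, 0 ≤ V ω t
  W_mem : ∀ ω, ∀ t ∈ Finset.Icc 1 M.n, W ω t ∈ Set.Icc (0 : ℝ) 1
  V_ro : ∀ ω (t : M.ro), V ω t = M.v (I ω t)
  W_ro : ∀ ω (t : M.ro), W ω t = M.w (I ω t)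
  /-- The algorithm may use any optimal solution. For `t < 4Γℓ` the program is infeasible, and
  nothing is required of `X ω t`, so that every convention for these times is allowed. -/
  X_optimal : ∀ ω, ∀ t ∈ Finset.Icc 1 M.n, (∃ x, M.LPFeasible (W ω) t x) →
    M.LPOptimal (V ω) (W ω) t (X ω t)

/-- The event `F_t = 0`: the algorithm is blocked at time `t`. -/
def BaroRun.blocked {M : BaroInstance} {Ω : Type*} [MeasurableSpace Ω]
    {P : MeasureTheory.Measure Ω} (S : BaroRun M P) (a₄ : ℝ) (t : ℕ) : Set Ω :=
  {ω | ¬ M.Unblocked a₄ (S.W ω) (M.xalg a₄ (S.W ω) (S.X ω)) t}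


/-!
Let `D` be the densest items, of total size about `k`. In a uniformly random order the positions of
the items are negatively dependent: the probability that a given set of items arrives within a set
of times is at most as large as for independent arrivals. The Chernoff bound therefore holds for the
weight of `D` that arrives during a set of times. With probability at least `1 - 2/k` the order is
typical: no window receives too much weight of `D`, and the free times before each window receive
enough of it to exhaust the scaled budget of the linear program.

In a typical order, an optimal solution that used a free item outside of `D` would leave part of an
item of `D` unused, whose window would not be full or would contain another item outside of `D`;
moving capacity to the item of `D` would increase the value. So all picks outside of `D` fall into
the first `4Γ` windows, where the linear programs may be infeasible, and the at most `Γ`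
adversarial windows. The outer constraint bounds the picks in those windows by `O(Γ ln k)` in
total. The algorithm can thus be blocked in a typical order only if the weight of `D` arriving
before `t`, which has mean about `kt/n`, exceeds this mean by order `kδ`, where `δ` is the slack of
the theorem, and that has probability at most `exp(-kδ²/8)`.
-/

section Counting

open Finset

variable {α β : Type*} [Fintype α] [Fintype β] [DecidableEq α] [DecidableEq β]

/-- The bijections that send `a` to `i` and place every item of `S` inside `T`. -/
def placings (a : α) (i : β) (T : Finset α) (S : Finset β) : Finset (α ≃ β) :=
  {σ | σ a = i ∧ ∀ r ∈ S, σ.symm r ∈ T}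

theorem mem_placings {a : α} {i : β} {T : Finset α} {S : Finset β} {σ : α ≃ β} :
    σ ∈ placings a i T S ↔ σ a = i ∧ ∀ r ∈ S, σ.symm r ∈ T := by
  simp [placings]

/- Double counting: from `σ` and a position `u ≠ a`, either `σ u ∈ S` and `(u, σ)` is recorded, or
the items at `u` and at the position `v` of `j` are exchanged and `v` is recorded with the new
bijection. -/
theorem card_sub_one_mul_card_placings_insert_le {a : α} {i : β} {T : Finset α} (ha : a ∉ T)
    {S : Finset β} {j : β} (hj : j ∉ S) :
    (Fintype.card α - 1) * #(placings a i T (insert j S)) ≤ #T * #(placings a i T S) := by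
  let recover : α × (α ≃ β) → α × (α ≃ β) := fun q =>
    if q.2 q.1 ∈ S then q else (q.2.symm j, (Equiv.swap (q.2.symm j) q.1).trans q.2)
  rw [← card_univ, ← card_erase_of_mem (mem_univ a), ← card_product, ← card_product]
  refine card_le_card_of_surjOn recover ?_
  rintro ⟨u, σ⟩ hq
  simp only [coe_product, Set.mem_prod, mem_coe, mem_erase, mem_univ, and_true, mem_placings,
    forall_mem_insert] at hq
  obtain ⟨hua, hσa, hσj, hσS⟩ := hq
  simp only [Set.mem_image, coe_product, Set.mem_prod, mem_coe, mem_placings, Prod.exists]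
  by_cases hu : σ u ∈ S
  · exact ⟨u, σ, ⟨by simpa using hσS _ hu, hσa, hσS⟩, by simp [recover, hu]⟩
  · have hva : σ.symm j ≠ a := ne_of_mem_of_not_mem hσj ha
    refine ⟨σ.symm j, (Equiv.swap u (σ.symm j)).trans σ, ⟨hσj, ?_, fun r hr => ?_⟩, ?_⟩
    · rw [Equiv.trans_apply, Equiv.swap_apply_of_ne_of_ne hua.symm hva.symm, hσa]
    · have hru : σ.symm r ≠ u := fun h => hu (by rwa [← h, Equiv.apply_symm_apply])
      have hrv : σ.symm r ≠ σ.symm j := σ.symm.injective.ne (ne_of_mem_of_not_mem hr hj)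
      simpa [Equiv.swap_apply_of_ne_of_ne hru hrv] using hσS r hr
    · simp [recover, hu, ← Equiv.trans_assoc]

theorem card_sub_one_pow_mul_card_placings_le {a : α} {i : β} {T : Finset α} (ha : a ∉ T)
    (S : Finset β) :
    (Fintype.card α - 1) ^ #S * #(placings a i T S) ≤ #T ^ #S * #(placings a i T ∅) := by
  induction S using Finset.induction_on with
  | empty => simp
  | insert j S hj ih =>
    calc (Fintype.card α - 1) ^ #(insert j S) * #(placings a i T (insert j S))
        = (Fintype.card α - 1) ^ #S *
            ((Fintype.card α - 1) * #(placings a i T (insert j S))) := by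
          rw [card_insert_of_notMem hj, pow_succ, mul_assoc]
      _ ≤ (Fintype.card α - 1) ^ #S * (#T * #(placings a i T S)) := by
          exact Nat.mul_le_mul_left _ (card_sub_one_mul_card_placings_insert_le ha hj)
      _ = #T * ((Fintype.card α - 1) ^ #S * #(placings a i T S)) := by ring
      _ ≤ #T * (#T ^ #S * #(placings a i T ∅)) := by gcongr
      _ = #T ^ #(insert j S) * #(placings a i T ∅) := by
          rw [card_insert_of_notMem hj, pow_succ']; ring

end Counting

section Sampling

open Finset MeasureTheory ProbabilityTheory

theorem exp_mul_sub_one_le {y θ : ℝ} (hy : y ∈ Set.Icc (0 : ℝ) 1) (hθ : θ ∈ Set.Icc (0 : ℝ) 1) :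
    Real.exp (θ * y) - 1 ≤ y * (θ + θ ^ 2) := by
  have h0 : 0 ≤ θ * y := mul_nonneg hθ.1 hy.1
  have hexp : Real.exp (θ * y) - 1 - θ * y ≤ (θ * y) ^ 2 :=
    (le_abs_self _).trans (Real.abs_exp_sub_one_sub_id_le
      (by rw [abs_of_nonneg h0]; exact mul_le_one₀ hθ.2 hy.1 hy.2))
  nlinarith [mul_le_mul_of_nonneg_left (mul_le_of_le_one_left hy.1 hy.2) (sq_nonneg θ)]

theorem exp_mul_sum_comp_equiv {α β : Type*} [Fintype β] (T : Finset α) (y : β → ℝ) (θ : ℝ)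
    (σ : α ≃ β) :
    Real.exp (θ * ∑ u ∈ T, y (σ u)) =
      ∑ S : Finset β, (∏ j ∈ S, (Real.exp (θ * y j) - 1)) *
        {σ : α ≃ β | ∀ j ∈ S, σ.symm j ∈ T}.indicator 1 σ := by
  classical
  have := Fintype.ofEquiv β σ.symm
  have hterm (j : β) : (if σ.symm j ∈ T then Real.exp (θ * y j) else 1) =
      (if σ.symm j ∈ T then Real.exp (θ * y j) - 1 else 0) + 1 := by
    split_ifs <;> simp
  calc Real.exp (θ * ∑ u ∈ T, y (σ u)) = ∏ u ∈ T, Real.exp (θ * y (σ u)) := by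
        rw [mul_sum, Real.exp_sum]
    _ = ∏ j, if σ.symm j ∈ T then Real.exp (θ * y j) else 1 := by
        simp [← Equiv.prod_comp σ]
    _ = ∑ S : Finset β, ∏ j ∈ S, if σ.symm j ∈ T then Real.exp (θ * y j) - 1 else 0 := by
        simp_rw [hterm, prod_add_one, powerset_univ]
    _ = _ := by
        refine sum_congr rfl fun S _ => ?_
        rw [prod_ite_zero, Set.indicator_apply]
        simp

variable {α β : Type*} [MeasurableSpace (α ≃ β)]

/-- The law of a uniformly random bijection conditional on the item at `a` being `i`. -/
noncomputable def pinnedLaw (a : α) (i : β) : Measure (α ≃ β) := uniformOn {σ | σ a = i}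

instance (a : α) (i : β) : IsZeroOrProbabilityMeasure (pinnedLaw a i) := by
  unfold pinnedLaw; infer_instance

variable [DiscreteMeasurableSpace (α ≃ β)] [Fintype α]

theorem pinnedLaw_real_placing_eq [Fintype β] [DecidableEq α] [DecidableEq β] (a : α) (i : β)
    (T : Finset α) (S : Finset β) :
    (pinnedLaw a i).real {σ | ∀ j ∈ S, σ.symm j ∈ T} =
      #(placings a i T S) / #(placings a i T ∅) := by
  have hpin : ({σ | σ a = i} : Set (α ≃ β)) = placings a i T ∅ := by ext; simp [placings]
  have hplace : (placings a i T ∅ : Set (α ≃ β)) ∩ {σ | ∀ j ∈ S, σ.symm j ∈ T} =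
      placings a i T S := by
    ext; simp [placings]
  have hsub : placings a i T S ⊆ placings a i T ∅ := fun σ => by
    simp +contextual [placings]
  rw [pinnedLaw, hpin, measureReal_def, ← uniformOn_inter_self (finite_toSet _), hplace,
    uniformOn_apply_finset, inter_eq_right.2 hsub, ENNReal.toReal_div, ENNReal.toReal_natCast,
    ENNReal.toReal_natCast]

theorem pinnedLaw_real_placing_le_pow [Finite β] {a : α} {i : β} {T : Finset α} (ha : a ∉ T)
    (S : Finset β) :
    (pinnedLaw a i).real {σ | ∀ j ∈ S, σ.symm j ∈ T} ≤
      ((#T : ℝ) / (Fintype.card α - 1)) ^ #S := by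
  classical
  cases nonempty_fintype β
  have hα : Fintype.card α ≠ 0 := (Fintype.card_pos_iff.2 ⟨a⟩).ne'
  rw [pinnedLaw_real_placing_eq, ← Nat.cast_pred (Nat.pos_of_ne_zero hα)]
  obtain hα' | hα' := Nat.eq_zero_or_pos (Fintype.card α - 1)
  · obtain rfl : T = ∅ := by
      refine eq_empty_of_forall_notMem fun u hu => ha ?_
      rwa [Fintype.card_le_one_iff.1 (Nat.sub_eq_zero_iff_le.1 hα') a u]
    obtain rfl | ⟨j, hj⟩ := S.eq_empty_or_nonempty
    · simpa using div_self_le_one _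
    · have : placings a i ∅ S = ∅ :=
        eq_empty_of_forall_notMem fun σ hσ => notMem_empty _ ((mem_placings.1 hσ).2 j hj)
      simp [this]
  · rw [div_pow]
    refine div_le_of_le_mul₀ (by positivity) (by positivity) ?_
    rw [div_mul_eq_mul_div, le_div_iff₀ (by positivity), mul_comm]
    exact_mod_cast card_sub_one_pow_mul_card_placings_le ha S

theorem mgf_sum_pinnedLaw_le [Fintype β] {a : α} {i : β} {T : Finset α} (ha : a ∉ T) {y : β → ℝ}
    (hy : ∀ j, y j ∈ Set.Icc (0 : ℝ) 1) {θ : ℝ} (hθ : θ ∈ Set.Icc (0 : ℝ) 1) :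
    mgf (fun σ => ∑ u ∈ T, y (σ u)) (pinnedLaw a i) θ ≤
      Real.exp ((#T : ℝ) / (Fintype.card α - 1) * (∑ j, y j) * (θ + θ ^ 2)) := by
  classical
  let p : ℝ := (#T : ℝ) / (Fintype.card α - 1)
  let z : β → ℝ := fun j => Real.exp (θ * y j) - 1
  have hp : 0 ≤ p := div_nonneg (Nat.cast_nonneg _) <| sub_nonneg.2 <|
    by exact_mod_cast Fintype.card_pos_iff.2 ⟨a⟩
  have hz (j : β) : 0 ≤ z j := sub_nonneg.2 (Real.one_le_exp (mul_nonneg hθ.1 (hy j).1))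
  calc mgf (fun σ => ∑ u ∈ T, y (σ u)) (pinnedLaw a i) θ
      = ∑ S : Finset β, (∏ j ∈ S, z j) *
          (pinnedLaw a i).real {σ | ∀ j ∈ S, σ.symm j ∈ T} := by
        simp_rw [mgf, exp_mul_sum_comp_equiv]
        rw [integral_finsetSum _ fun _ _ => .of_finite]
        simp_rw [integral_const_mul, integral_indicator_one (MeasurableSet.of_discrete), z]
    _ ≤ ∑ S : Finset β, (∏ j ∈ S, z j) * p ^ #S := by
        gcongr with S
        · exact prod_nonneg fun j _ => hz j
        · exact pinnedLaw_real_placing_le_pow ha S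
    _ = ∏ j, (p * z j + 1) := by
        rw [prod_add_one, powerset_univ]
        exact sum_congr rfl fun S _ => by rw [prod_mul_distrib, prod_const, mul_comm]
    _ ≤ ∏ j, Real.exp (p * (y j * (θ + θ ^ 2))) := by
        gcongr with j
        · exact fun j _ => add_nonneg (mul_nonneg hp (hz j)) zero_le_one
        · exact (Real.add_one_le_exp _).trans (Real.exp_le_exp.2
            (mul_le_mul_of_nonneg_left (exp_mul_sub_one_le (hy j) hθ) hp))
    _ = Real.exp (p * (∑ j, y j) * (θ + θ ^ 2)) := by
        rw [← Real.exp_sum, mul_assoc, sum_mul, mul_sum]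

theorem pinnedLaw_real_le_sum_le [Fintype β] {a : α} {i : β} {T : Finset α} (ha : a ∉ T)
    {y : β → ℝ} (hy : ∀ j, y j ∈ Set.Icc (0 : ℝ) 1) {θ : ℝ} (hθ : θ ∈ Set.Icc (0 : ℝ) 1)
    {c κ lam : ℝ} (hκ : (#T : ℝ) / (Fintype.card α - 1) * ∑ j, y j ≤ κ)
    (hc : (#T : ℝ) / (Fintype.card α - 1) * ∑ j, y j + lam ≤ c) :
    (pinnedLaw a i).real {σ | c ≤ ∑ u ∈ T, y (σ u)} ≤ Real.exp (θ ^ 2 * κ - θ * lam) := by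
  have hchernoff := (measure_ge_le_exp_mul_mgf (μ := pinnedLaw a i) c hθ.1 .of_finite).trans
    (mul_le_mul_of_nonneg_left (mgf_sum_pinnedLaw_le ha hy hθ) (Real.exp_nonneg _))
  rw [← Real.exp_add] at hchernoff
  refine hchernoff.trans (Real.exp_le_exp.2 ?_)
  nlinarith [mul_le_mul_of_nonneg_left hc hθ.1, mul_le_mul_of_nonneg_left hκ (sq_nonneg θ)]

/- A small sum over `T` forces a large sum over the complement of `insert a T`. -/
theorem pinnedLaw_real_sum_le_le [Fintype β] {a : α} {i : β} {T : Finset α} (ha : a ∉ T)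
    {y : β → ℝ} (hy : ∀ j, y j ∈ Set.Icc (0 : ℝ) 1) {θ : ℝ} (hθ : θ ∈ Set.Icc (0 : ℝ) 1)
    {c lam : ℝ} (hc : c + 1 + lam ≤ (#T : ℝ) / (Fintype.card α - 1) * ∑ j, y j) :
    (pinnedLaw a i).real {σ | ∑ u ∈ T, y (σ u) ≤ c} ≤
      Real.exp (θ ^ 2 * ∑ j, y j - θ * lam) := by
  classical
  let R : Finset α := (insert a T)ᶜ
  have haR : a ∉ R := by simp [R]
  have hY : 0 ≤ ∑ j, y j := sum_nonneg fun j _ => (hy j).1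
  have hcard : (#R : ℝ) = (Fintype.card α - 1) - #T := by
    rw [card_compl, Nat.cast_sub (card_le_univ _), card_insert_of_notMem ha]
    push_cast; ring
  have hfrac : (#R : ℝ) / (Fintype.card α - 1) ≤ 1 - (#T : ℝ) / (Fintype.card α - 1) := by
    rw [hcard, sub_div]
    gcongr
    exact div_self_le_one _
  have hmean := mul_le_mul_of_nonneg_right hfrac hY
  have hTmean : 0 ≤ (#T : ℝ) / (Fintype.card α - 1) * ∑ j, y j :=
    mul_nonneg (div_nonneg (Nat.cast_nonneg _) (sub_nonneg.2
      (by exact_mod_cast Fintype.card_pos_iff.2 ⟨a⟩))) hY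
  refine (measureReal_mono fun σ (hσ : _ ≤ c) => ?_).trans
    (pinnedLaw_real_le_sum_le (c := ∑ j, y j - 1 - c) haR hy hθ (by linarith) (by linarith))
  have hsplit : ∑ u ∈ R, y (σ u) + (y (σ a) + ∑ u ∈ T, y (σ u)) = ∑ j, y j := by
    rw [← sum_insert (f := fun u => y (σ u)) ha, sum_compl_add_sum, Equiv.sum_comp σ y]
  rw [Set.mem_ofPred_eq]
  linarith [(hy (σ a)).2]

end Sampling

section Greedy

open Finset

theorem exists_upper_finset_sum_near {ι δ : Type*} [Fintype ι] [LinearOrder δ] {d : ι → δ}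
    {w : ι → ℝ} (hd : Function.Injective d) (hw : ∀ i, w i ≤ 1) {k : ℝ} (hk : 0 ≤ k) :
    ∃ D : Finset ι, (∀ i ∈ D, ∀ j ∉ D, d j < d i) ∧ ∑ i ∈ D, w i ≤ k + 1 ∧
      (D = univ ∨ k ≤ ∑ i ∈ D, w i) := by
  classical
  let IsLight : Finset ι → Prop := fun D =>
    (∀ i ∈ D, ∀ j ∉ D, d j < d i) ∧ ∑ i ∈ D, w i ≤ k + 1
  have hempty : IsLight ∅ := ⟨by simp, by simpa using by linarith⟩
  obtain ⟨D, hD, hmax⟩ := exists_max_image ({D | IsLight D} : Finset (Finset ι)) card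
    ⟨∅, by simpa using hempty⟩
  have hD : IsLight D := (mem_filter.1 hD).2
  refine ⟨D, hD.1, hD.2, ?_⟩
  by_contra! hcon
  obtain ⟨j, hj, hjmax⟩ := exists_max_image Dᶜ d
    (nonempty_iff_ne_empty.2 (by simpa using hcon.1))
  have hjD : j ∉ D := mem_compl.1 hj
  have hinsert : IsLight (insert j D) := by
    refine ⟨fun i hi r hr => ?_, by rw [sum_insert hjD]; linarith [hw j]⟩
    obtain ⟨hrj, hrD⟩ : r ≠ j ∧ r ∉ D := by simpa using hr
    rcases mem_insert.1 hi with rfl | hi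
    · exact (hjmax r (mem_compl.2 hrD)).lt_of_ne (hd.ne hrj)
    · exact hD.1 i hi r hrD
  have := hmax _ (mem_filter.2 ⟨mem_univ _, hinsert⟩)
  rw [card_insert_of_notMem hjD] at this
  omega

end Greedy

theorem mem_baroWindow_iff {ℓ b t : ℕ} (ht : 1 ≤ t) (hℓ : 0 < ℓ) :
    t ∈ baroWindow ℓ b ↔ (t - 1) / ℓ = b := by
  rw [baroWindow, Finset.mem_Icc, Nat.div_eq_iff hℓ, add_mul, one_mul]
  omega

theorem mem_baroWindow_div {ℓ t : ℕ} (ht : 1 ≤ t) (hℓ : 0 < ℓ) :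
    t ∈ baroWindow ℓ ((t - 1) / ℓ) :=
  (mem_baroWindow_iff ht hℓ).2 rfl

theorem card_baroWindow (ℓ b : ℕ) : (baroWindow ℓ b).card = ℓ := by
  rw [baroWindow, Nat.card_Icc, add_mul, one_mul]; omega

theorem baroLast_eq {ℓ t : ℕ} (ht : 1 ≤ t) (hℓ : 0 < ℓ) :
    baroLast ℓ t = baroWindow ℓ ((t - 1) / ℓ) ∩ Finset.Ico 1 t := by
  ext s
  have := Nat.lt_div_mul_add (a := t - 1) hℓ
  simp only [baroLast, baroWindow, Finset.mem_inter, Finset.mem_Icc, Finset.mem_Ico, add_mul,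
    one_mul]
  omega

namespace BaroInstance

theorem n_pos (M : BaroInstance) : (0 : ℝ) < M.n := by linarith [M.k_ge, M.k_le]

theorem k_pos (M : BaroInstance) : 0 < M.k := by linarith [M.k_ge]

theorem four_le_log_k (M : BaroInstance) : 4 ≤ Real.log M.k := by
  rw [Real.le_log_iff_exp_le M.k_pos]
  calc Real.exp 4 = Real.exp 1 ^ 4 := by rw [← Real.exp_nat_mul]; norm_num
    _ ≤ 2.72 ^ 4 := by
        gcongr
        linarith [Real.exp_one_lt_d9]
    _ ≤ 80 := by norm_num
    _ ≤ M.k := M.k_ge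

theorem eight_le_sqrt_k (M : BaroInstance) : 8 ≤ Real.sqrt M.k :=
  Real.le_sqrt_of_sq_le (by linarith [M.k_ge])

theorem eight_le_Γ (M : BaroInstance) : (8 : ℝ) ≤ M.Γ := M.eight_le_sqrt_k.trans M.Γ_ge

theorem log_k_le_sqrt_k (M : BaroInstance) : Real.log M.k ≤ Real.sqrt M.k := by
  have hs : 0 < Real.sqrt M.k := by linarith [M.eight_le_sqrt_k]
  have hlog : Real.log M.k = 2 * Real.log (Real.sqrt M.k) := by
    rw [Real.log_sqrt M.k_pos.le]; ring
  have hhalf : Real.log (Real.sqrt M.k / 2) ≤ Real.sqrt M.k / 2 - 1 :=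
    Real.log_le_sub_one_of_pos (by linarith)
  rw [Real.log_div hs.ne' two_ne_zero] at hhalf
  linarith [Real.log_two_lt_d9]

/-- The share `(ℓ/n) k` of the knapsack that belongs to one window; it is `ln k` up to rounding. -/
noncomputable def share (M : BaroInstance) : ℝ := M.ℓ / M.n * M.k

theorem abs_share_sub_log_k_le (M : BaroInstance) :
    |M.share - Real.log M.k| ≤ 1 / 8 * Real.log M.k := by
  have hk := M.k_pos
  have hn := M.n_pos
  have hrounding : M.share - Real.log M.k =
      (M.ℓ - M.n * Real.log M.k / M.k) * (M.k / M.n) := by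
    rw [share]; field_simp
  have hkn : M.k / M.n ≤ 1 / 2 := by rw [div_le_iff₀ hn]; linarith [M.k_le]
  calc |M.share - Real.log M.k|
      = |M.ℓ - M.n * Real.log M.k / M.k| * (M.k / M.n) := by
        rw [hrounding, abs_mul, abs_of_pos (div_pos hk hn)]
    _ ≤ 1 * (1 / 2) := by gcongr; exact M.ℓ_eq.le
    _ ≤ 1 / 8 * Real.log M.k := by linarith [M.four_le_log_k]

theorem le_share (M : BaroInstance) : 7 / 8 * Real.log M.k ≤ M.share := by
  linarith [(abs_le.1 M.abs_share_sub_log_k_le).1]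

theorem share_le (M : BaroInstance) : M.share ≤ 9 / 8 * Real.log M.k := by
  linarith [(abs_le.1 M.abs_share_sub_log_k_le).2]

theorem seven_halves_le_share (M : BaroInstance) : 7 / 2 ≤ M.share := by
  linarith [M.le_share, M.four_le_log_k]

theorem share_pos (M : BaroInstance) : 0 < M.share := by linarith [M.seven_halves_le_share]

theorem ℓ_pos (M : BaroInstance) : 0 < M.ℓ := by
  by_contra! h
  have := M.share_pos
  simp [share, Nat.le_zero.1 h] at this

theorem div_mul_k_eq (M : BaroInstance) (t : ℕ) : (t : ℝ) / M.n * M.k = t / M.ℓ * M.share := by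
  have : (M.ℓ : ℝ) ≠ 0 := by exact_mod_cast M.ℓ_pos.ne'
  rw [share]; field_simp

theorem scale_mul_eq (M : BaroInstance) {s : ℕ} (hs : s ≠ 0) :
    M.scale s * (s / M.n) * M.k = (s / M.ℓ - 4 * M.Γ) * M.share := by
  have hℓ : (M.ℓ : ℝ) ≠ 0 := by exact_mod_cast M.ℓ_pos.ne'
  have hn := M.n_pos.ne'
  have hs : (s : ℝ) ≠ 0 := by exact_mod_cast hs
  rw [scale, share]
  field_simp

theorem card_windows_le (M : BaroInstance) : ((M.n / M.ℓ + 1 : ℕ) : ℝ) ≤ M.k := by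
  have hdiv : (M.n : ℝ) / M.ℓ * M.share = M.k := by
    rw [← M.div_mul_k_eq, div_self M.n_pos.ne', one_mul]
  have hnonneg : (0 : ℝ) ≤ M.n / M.ℓ := by positivity
  have hfloor : ((M.n / M.ℓ : ℕ) : ℝ) ≤ M.n / M.ℓ := Nat.cast_div_le
  push_cast
  nlinarith [M.seven_halves_le_share, M.k_ge]

theorem IsFree.of_mem_baroWindow {M : BaroInstance} {u r b : ℕ} (hu : M.IsFree u)
    (hub : u ∈ baroWindow M.ℓ b) (hr : r ∈ Finset.Icc 1 M.n) (hrb : r ∈ baroWindow M.ℓ b) :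
    M.IsFree r := by
  refine ⟨hr, fun b' hb' hrb' => hu.2 b' hb' ?_⟩
  rw [mem_baroWindow_iff (Finset.mem_Icc.1 hr).1 M.ℓ_pos] at hrb hrb'
  rwa [← hrb', hrb]

/-- The union of the adversarial windows. -/
def advUnion (M : BaroInstance) : Finset ℕ := M.advWindows.biUnion (baroWindow M.ℓ)

theorem isFree_iff (M : BaroInstance) {t : ℕ} :
    M.IsFree t ↔ t ∈ Finset.Icc 1 M.n ∧ t ∉ M.advUnion := by
  simp [IsFree, advUnion]

theorem card_advUnion_le (M : BaroInstance) : M.advUnion.card ≤ M.Γ * M.ℓ :=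
  (Finset.card_biUnion_le_card_mul _ _ _ fun b _ => (card_baroWindow M.ℓ b).le).trans
    (Nat.mul_le_mul_right _ M.advWindows_card)

theorem card_adv_le (M : BaroInstance) : M.adv.card ≤ M.Γ * M.ℓ := by
  refine (Finset.card_le_card fun t ht => ?_).trans M.card_advUnion_le
  simpa [advUnion] using M.adv_covered t ht

theorem card_ro_le (M : BaroInstance) : M.ro.card ≤ M.n := by
  simpa using Finset.card_le_card (Finset.sdiff_subset (s := Finset.Icc 1 M.n) (t := M.adv))

theorem le_card_ro (M : BaroInstance) : M.n ≤ M.ro.card + M.Γ * M.ℓ := by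
  have := Finset.le_card_sdiff M.adv (Finset.Icc 1 M.n)
  have := M.card_adv_le
  rw [Nat.card_Icc] at *
  lia

end BaroInstance

/-- The solution `x` after an amount `ε` of capacity has been moved from item `r` to item `u`. -/
noncomputable def moveCapacity (W x : ℕ → ℝ) (r u : ℕ) (ε : ℝ) : ℕ → ℝ :=
  x + Pi.single u (ε / W u) - Pi.single r (ε / W r)

theorem sum_mul_moveCapacity (c W x : ℕ → ℝ) (r u : ℕ) (ε : ℝ) (A : Finset ℕ) :
    ∑ j ∈ A, c j * moveCapacity W x r u ε j =
      ∑ j ∈ A, c j * x j + (if u ∈ A then c u * (ε / W u) else 0) -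
        (if r ∈ A then c r * (ε / W r) else 0) := by
  simp [moveCapacity, mul_sub, mul_add, Finset.sum_sub_distrib, Finset.sum_add_distrib,
    Pi.single_apply]

theorem exists_pos_of_sum_lt {W x : ℕ → ℝ} {A F : Finset ℕ} (hW : ∀ r ∈ A, 0 ≤ W r)
    (hx : ∀ r ∈ A, x r ≤ 1) (hF : ∑ r ∈ A ∩ F, W r < ∑ r ∈ A, W r * x r) :
    ∃ r ∈ A, r ∉ F ∧ 0 < x r := by
  by_contra! hcon
  refine hF.not_ge ?_
  rw [← Finset.sum_ite_mem]
  refine Finset.sum_le_sum fun r hr => ?_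
  split_ifs with hrF
  · exact mul_le_of_le_one_right (hW r hr) (hx r hr)
  · exact mul_nonpos_of_nonneg_of_nonpos (hW r hr) (hcon r hr hrF)

namespace BaroInstance

section LP

variable {M : BaroInstance} {V W x : ℕ → ℝ} {s : ℕ}

theorem LPFeasible.sum_window_le (h : M.LPFeasible W s x) (b : ℕ) :
    ∑ r ∈ baroWindow M.ℓ b ∩ Finset.Icc 1 s, W r * x r ≤ 601 * M.share := by
  simpa only [share, mul_assoc] using h.2.1 b

theorem LPFeasible.moveCapacity (h : M.LPFeasible W s x) {u r : ℕ} (hur : u ≠ r)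
    (hu : u ∈ Finset.Icc 1 s) (hr : r ∈ Finset.Icc 1 s) (hWu : 0 < W u) (hWr : 0 < W r)
    {ε : ℝ} (hε : 0 ≤ ε) (hεu : ε ≤ W u * (1 - x u)) (hεr : ε ≤ W r * x r)
    (hwin : ∀ b, u ∈ baroWindow M.ℓ b → r ∈ baroWindow M.ℓ b ∨
      ∑ j ∈ baroWindow M.ℓ b ∩ Finset.Icc 1 s, W j * x j + ε ≤ 601 * M.share) :
    M.LPFeasible W s (moveCapacity W x r u ε) := by
  have hcu : W u * (ε / W u) = ε := mul_div_cancel₀ _ hWu.ne'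
  have hcr : W r * (ε / W r) = ε := mul_div_cancel₀ _ hWr.ne'
  refine ⟨?_, fun b => ?_, fun j hj => ?_⟩
  · rw [sum_mul_moveCapacity, if_pos hu, if_pos hr, hcu, hcr]
    linarith [h.1]
  · rw [sum_mul_moveCapacity, hcu, hcr, mul_assoc, ← share]
    have hb := h.sum_window_le b
    simp only [Finset.mem_inter, hu, hr, and_true]
    by_cases hub : u ∈ baroWindow M.ℓ b
    · rcases hwin b hub with hrb | hslack
      · rw [if_pos hub, if_pos hrb]; linarith
      · split_ifs <;> linarith
    · split_ifs <;> linarith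
  · have hxj := h.2.2 j hj
    have hu0 : 0 ≤ ε / W u := by positivity
    have hr0 : 0 ≤ ε / W r := by positivity
    have hu1 : ε / W u ≤ 1 - x u := by rwa [div_le_iff₀' hWu]
    have hr1 : ε / W r ≤ x r := by rwa [div_le_iff₀' hWr]
    simp only [_root_.moveCapacity, Pi.sub_apply, Pi.add_apply, Pi.single_apply]
    split_ifs with hju hjr hjr
    · exact absurd (hju.symm.trans hjr) hur
    · subst hju; constructor <;> linarith
    · subst hjr; constructor <;> linarith
    · simpa using hxj

/- Otherwise moving a little capacity from `r` to `u` would improve the solution. -/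
theorem LPOptimal.density_le (h : M.LPOptimal V W s x) {u r b : ℕ} (hu : u ∈ Finset.Icc 1 s)
    (hr : r ∈ Finset.Icc 1 s) (hWu : 0 < W u) (hWr : 0 < W r) (hxu : x u < 1) (hxr : 0 < x r)
    (hub : u ∈ baroWindow M.ℓ b)
    (hslack : r ∈ baroWindow M.ℓ b ∨
      ∑ j ∈ baroWindow M.ℓ b ∩ Finset.Icc 1 s, W j * x j < 601 * M.share) :
    V u / W u ≤ V r / W r := by
  obtain rfl | hur := eq_or_ne u r
  · exact le_rfl
  obtain ⟨ε, hε, hεu, hεr, hεs⟩ : ∃ ε : ℝ, 0 < ε ∧ ε ≤ W u * (1 - x u) ∧ ε ≤ W r * x r ∧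
      (r ∈ baroWindow M.ℓ b ∨
        ∑ j ∈ baroWindow M.ℓ b ∩ Finset.Icc 1 s, W j * x j + ε ≤ 601 * M.share) := by
    have hpos : 0 < min (W u * (1 - x u)) (W r * x r) :=
      lt_min (mul_pos hWu (sub_pos.2 hxu)) (mul_pos hWr hxr)
    rcases hslack with hrb | hlt
    · exact ⟨_, hpos, min_le_left _ _, min_le_right _ _, .inl hrb⟩
    · refine ⟨_, lt_min hpos (sub_pos.2 hlt), (min_le_left _ _).trans (min_le_left _ _),
        (min_le_left _ _).trans (min_le_right _ _), .inr ?_⟩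
      rw [add_comm, ← le_sub_iff_add_le]
      exact min_le_right _ _
  have hfeas := h.1.moveCapacity hur hu hr hWu hWr hε.le hεu hεr fun b' hub' => by
    rw [mem_baroWindow_iff (Finset.mem_Icc.1 hu).1 M.ℓ_pos] at hub hub'
    rwa [← hub', hub]
  have hopt := h.2 _ hfeas
  rw [sum_mul_moveCapacity, if_pos hu, if_pos hr] at hopt
  refine le_of_mul_le_mul_left ?_ hε
  linarith [mul_div_left_comm (V u) ε (W u), mul_div_left_comm (V r) ε (W r)]

theorem LPFeasible.exists_lt_one (h : M.LPFeasible W s x) (hW : ∀ u ∈ Finset.Icc 1 s, 0 ≤ W u)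
    {F : Finset ℕ} (hF : F ⊆ Finset.Icc 1 s)
    (hbudget : M.scale s * (s / M.n) * M.k < ∑ u ∈ F, W u) : ∃ u ∈ F, x u < 1 := by
  by_contra! hcon
  refine hbudget.not_ge (le_trans ?_ h.1)
  calc ∑ u ∈ F, W u ≤ ∑ u ∈ F, W u * x u :=
        Finset.sum_le_sum fun u hu => le_mul_of_one_le_right (hW u (hF hu)) (hcon u hu)
    _ ≤ ∑ u ∈ Finset.Icc 1 s, W u * x u :=
        Finset.sum_le_sum_of_subset_of_nonneg hF fun u hu _ =>
          mul_nonneg (hW u hu) (h.2.2 u hu).1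

theorem LPOptimal.nonpos_of_dense (h : M.LPOptimal V W s x)
    (hs : 1 ≤ s) (hW : ∀ u ∈ Finset.Icc 1 s, 0 ≤ W u) {F : Finset ℕ}
    (hF : F ⊆ Finset.Icc 1 s) (hsF : s ∉ F) (hWF : ∀ u ∈ F, 0 < W u)
    (hbudget : M.scale s * (s / M.n) * M.k < ∑ u ∈ F, W u)
    (hwin : ∀ b, ∑ r ∈ (baroWindow M.ℓ b ∩ Finset.Icc 1 s) ∩ F, W r < 601 * M.share)
    (hdense : ∀ u ∈ F, ∀ b, u ∈ baroWindow M.ℓ b →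
      ∀ r ∈ insert s (baroWindow M.ℓ b ∩ Finset.Icc 1 s), r ∉ F →
        0 < W r ∧ V r / W r < V u / W u) :
    x s ≤ 0 := by
  by_contra! hxs
  obtain ⟨u, huF, hxu⟩ := h.1.exists_lt_one hW hF hbudget
  obtain ⟨b, hub⟩ : ∃ b, u ∈ baroWindow M.ℓ b :=
    ⟨_, mem_baroWindow_div (Finset.mem_Icc.1 (hF huF)).1 M.ℓ_pos⟩
  rcases (h.1.sum_window_le b).lt_or_eq with hlt | hfull
  · obtain ⟨hWs, hlt_density⟩ := hdense u huF b hub s (Finset.mem_insert_self _ _) hsF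
    exact hlt_density.not_ge (h.density_le (hF huF) (Finset.mem_Icc.2 ⟨hs, le_rfl⟩) (hWF u huF)
      hWs hxu hxs hub (.inr hlt))
  · obtain ⟨r, hr, hrF, hxr⟩ := exists_pos_of_sum_lt
      (fun r hr => hW r (Finset.mem_inter.1 hr).2)
      (fun r hr => (h.1.2.2 r (Finset.mem_inter.1 hr).2).2) (hfull ▸ hwin b)
    obtain ⟨hWr, hlt_density⟩ := hdense u huF b hub r (Finset.mem_insert_of_mem hr) hrF
    exact hlt_density.not_ge (h.density_le (hF huF) (Finset.mem_inter.1 hr).2 (hWF u huF)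
      hWr hxu hxr hub (.inl (Finset.mem_inter.1 hr).1))

end LP

section Selections

variable (M : BaroInstance) {a₄ : ℝ} {W : ℕ → ℝ} (X : ℕ → ℕ → ℝ)

theorem sum_window_xalg_le (ha₄ : 0 ≤ a₄) (hW : ∀ t ∈ Finset.Icc 1 M.n, W t ≤ 1) (b : ℕ) {t : ℕ}
    (ht : t ≤ M.n) :
    ∑ s ∈ baroWindow M.ℓ b ∩ Finset.Icc 1 t, W s * M.xalg a₄ W X s ≤ a₄ * M.share := by
  classical
  induction t with
  | zero => simpa using mul_nonneg ha₄ M.share_pos.le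
  | succ t ih =>
    rw [← Finset.insert_Icc_right_eq_Icc_add_one (by omega)]
    by_cases hb : t + 1 ∈ baroWindow M.ℓ b
    · rw [Finset.inter_insert_of_mem hb, Finset.sum_insert (by simp), xalg_eq M a₄ W X (by omega)]
      split_ifs with hpicked
      · have houter := hpicked.2.1
        rw [baroLast_eq (by omega) M.ℓ_pos, (mem_baroWindow_iff (by omega) M.ℓ_pos).1 hb,
          Finset.Ico_add_one_right_eq_Icc, mul_assoc, ← share] at houter
        linarith [hW (t + 1) (Finset.mem_Icc.2 ⟨by omega, ht⟩)]
      · linarith [ih (by omega)]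
    · rw [Finset.inter_insert_of_notMem hb]
      exact ih (by omega)

end Selections

end BaroInstance

namespace BaroInstance

open MeasureTheory Finset

/-- The orders in which the random-order items can arrive. All sets of orders are measurable. -/
abbrev ArrivalOrder (M : BaroInstance) : Type := M.ro ≃ Fin M.ro.card

instance (M : BaroInstance) : MeasurableSpace M.ArrivalOrder := ⊤

instance (M : BaroInstance) : DiscreteMeasurableSpace M.ArrivalOrder := ⟨fun _ => trivial⟩

/-- The weight, for given item weights `y`, of the random-order item that arrives at time `s` in the
order `σ`. It is `0` at adversarial times. -/
noncomputable def itemLoad (M : BaroInstance) (y : Fin M.ro.card → ℝ) (σ : M.ArrivalOrder)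
    (s : ℕ) : ℝ :=
  if h : s ∈ M.ro then y (σ ⟨s, h⟩) else 0

/-- The probability that an item arrives during `A`, conditional on another item arriving at a
random-order time outside of `A`. -/
noncomputable def roFraction (M : BaroInstance) (A : Finset ℕ) : ℝ :=
  #(A ∩ M.ro) / (M.ro.card - 1)

section Tails

variable {M : BaroInstance} {y : Fin M.ro.card → ℝ} {t : ℕ} {A : Finset ℕ}

theorem itemLoad_nonneg (hy : ∀ j, 0 ≤ y j) (σ : M.ArrivalOrder) (s : ℕ) :
    0 ≤ M.itemLoad y σ s := by
  rw [itemLoad]; split_ifs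
  exacts [hy _, le_rfl]

theorem sum_itemLoad (y : Fin M.ro.card → ℝ) (σ : M.ArrivalOrder) (A : Finset ℕ) :
    ∑ s ∈ A, M.itemLoad y σ s = ∑ u ∈ A.subtype (· ∈ M.ro), y (σ u) := by
  have hload (u : M.ro) : y (σ u) = M.itemLoad y σ u := by rw [itemLoad, dif_pos u.2]
  simp_rw [hload]
  rw [sum_subtype_eq_sum_filter, sum_filter_of_ne]
  intro s _ hs
  by_contra hro
  exact hs (dif_neg hro)

theorem roFraction_eq (M : BaroInstance) (A : Finset ℕ) :
    M.roFraction A = #(A.subtype (· ∈ M.ro)) / (Fintype.card M.ro - 1) := by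
  rw [roFraction, card_subtype, filter_mem_eq_inter, Fintype.card_coe]

theorem card_inter_ro_lt (ht : t ∈ M.ro) (hA : t ∉ A) : #(A ∩ M.ro) + 1 ≤ M.ro.card :=
  card_lt_card ⟨inter_subset_right, fun h => hA (mem_inter.1 (h ht)).1⟩

theorem roFraction_nonneg (ht : t ∈ M.ro) : 0 ≤ M.roFraction A :=
  div_nonneg (Nat.cast_nonneg _) (sub_nonneg.2 (by exact_mod_cast card_pos.2 ⟨t, ht⟩))

theorem roFraction_le_one (ht : t ∈ M.ro) (hA : t ∉ A) : M.roFraction A ≤ 1 := by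
  have hlt : (#(A ∩ M.ro) : ℝ) + 1 ≤ M.ro.card := by exact_mod_cast card_inter_ro_lt ht hA
  exact div_le_one_of_le₀ (by linarith) (by linarith [(#(A ∩ M.ro)).cast_nonneg (α := ℝ)])

theorem pinnedLaw_real_le_sum_itemLoad_le (ht : t ∈ M.ro) (i : Fin M.ro.card) (hA : t ∉ A)
    (hy : ∀ j, y j ∈ Set.Icc (0 : ℝ) 1) {θ : ℝ} (hθ : θ ∈ Set.Icc (0 : ℝ) 1) {c κ lam : ℝ}
    (hκ : M.roFraction A * ∑ j, y j ≤ κ) (hc : M.roFraction A * ∑ j, y j + lam ≤ c) :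
    (pinnedLaw ⟨t, ht⟩ i).real {σ : M.ArrivalOrder | c ≤ ∑ s ∈ A, M.itemLoad y σ s} ≤
      Real.exp (θ ^ 2 * κ - θ * lam) := by
  rw [roFraction_eq] at hκ hc
  simp_rw [sum_itemLoad]
  exact pinnedLaw_real_le_sum_le (by simpa using hA) hy hθ hκ hc

theorem pinnedLaw_real_sum_itemLoad_le_le (ht : t ∈ M.ro) (i : Fin M.ro.card) (hA : t ∉ A)
    (hy : ∀ j, y j ∈ Set.Icc (0 : ℝ) 1) {θ : ℝ} (hθ : θ ∈ Set.Icc (0 : ℝ) 1) {c lam : ℝ}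
    (hc : c + 1 + lam ≤ M.roFraction A * ∑ j, y j) :
    (pinnedLaw ⟨t, ht⟩ i).real {σ : M.ArrivalOrder | ∑ s ∈ A, M.itemLoad y σ s ≤ c} ≤
      Real.exp (θ ^ 2 * ∑ j, y j - θ * lam) := by
  rw [roFraction_eq] at hc
  simp_rw [sum_itemLoad]
  exact pinnedLaw_real_sum_le_le (by simpa using hA) hy hθ hc

theorem le_card_ro_sub_one (hn : 8 * M.ℓ * (M.Γ + 2) ≤ M.n) :
    7 / 8 * (M.n : ℝ) ≤ M.ro.card - 1 := by
  have hn : (8 * M.ℓ * (M.Γ + 2) : ℝ) ≤ M.n := by exact_mod_cast hn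
  have hℓ : (1 : ℝ) ≤ M.ℓ := by exact_mod_cast M.ℓ_pos
  have hro : (M.n : ℝ) ≤ M.ro.card + M.Γ * M.ℓ := by exact_mod_cast M.le_card_ro
  linarith

theorem roFraction_window_le (hn : 8 * M.ℓ * (M.Γ + 2) ≤ M.n) {b : ℕ} (hA : A ⊆ baroWindow M.ℓ b) :
    M.roFraction A ≤ 8 / 7 * (M.ℓ / M.n) := by
  have hcard : (#(A ∩ M.ro) : ℝ) ≤ M.ℓ := by
    exact_mod_cast (card_le_card (inter_subset_left.trans hA)).trans (card_baroWindow _ _).le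
  calc M.roFraction A ≤ M.ℓ / (7 / 8 * M.n) :=
        div_le_div₀ (Nat.cast_nonneg _) hcard (by linarith [M.n_pos]) (le_card_ro_sub_one hn)
    _ = 8 / 7 * (M.ℓ / M.n) := by field_simp

theorem roFraction_Ico_le (ht : t ∈ M.ro) :
    M.roFraction (Ico 1 t) ≤ t / M.n + M.Γ * (M.ℓ / M.n) := by
  have hlate : Icc t M.n \ M.adv ⊆ M.ro \ (Ico 1 t ∩ M.ro) := fun s hs => by
    have := mem_Icc.1 (mem_sdiff.1 ht).1
    simp only [mem_sdiff, mem_Icc, mem_inter, mem_Ico] at hs ⊢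
    lia
  have hcard : #(Ico 1 t ∩ M.ro) + M.n + 1 ≤ M.ro.card + t + M.Γ * M.ℓ := by
    have := (le_card_sdiff M.adv (Icc t M.n)).trans (card_le_card hlate)
    rw [Nat.card_Icc, card_sdiff_of_subset inter_subset_right] at this
    have := M.card_adv_le
    have := card_inter_ro_lt ht (A := Ico 1 t) (by simp)
    lia
  have hN : (#(Ico 1 t ∩ M.ro) : ℝ) + 1 ≤ M.ro.card := by
    exact_mod_cast card_inter_ro_lt ht (by simp)
  have hro : (M.ro.card : ℝ) ≤ M.n := by exact_mod_cast M.card_ro_le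
  have hcard : (#(Ico 1 t ∩ M.ro) : ℝ) + M.n + 1 ≤ M.ro.card + t + M.Γ * M.ℓ := by
    exact_mod_cast hcard
  have : (0 : ℝ) ≤ #(Ico 1 t ∩ M.ro) := Nat.cast_nonneg _
  rw [← mul_div_assoc, ← add_div, roFraction]
  refine div_le_of_le_mul₀ (by linarith) (by positivity) ?_
  rw [div_mul_eq_mul_div, le_div_iff₀ M.n_pos]
  nlinarith [mul_nonneg (sub_nonneg.2 hN) (show 0 ≤ M.n - ((M.ro.card : ℝ) - 1) by linarith)]

theorem le_roFraction_free (hn : 8 * M.ℓ * (M.Γ + 2) ≤ M.n) {b : ℕ} (hb : b * M.ℓ ≤ M.n) :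
    (b - M.Γ) * (M.ℓ / M.n) ≤ M.roFraction (Icc 1 (b * M.ℓ) \ M.advUnion) := by
  have hfree : Icc 1 (b * M.ℓ) \ M.advUnion ⊆ (Icc 1 (b * M.ℓ) \ M.advUnion) ∩ M.ro := by
    refine fun s hs => mem_inter.2 ⟨hs, (M.isFree_iff.2 ⟨?_, (mem_sdiff.1 hs).2⟩).mem_ro⟩
    exact Icc_subset_Icc_right hb (mem_sdiff.1 hs).1
  have hcard : b * M.ℓ ≤ #((Icc 1 (b * M.ℓ) \ M.advUnion) ∩ M.ro) + M.Γ * M.ℓ := by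
    have := (le_card_sdiff M.advUnion (Icc 1 (b * M.ℓ))).trans (card_le_card hfree)
    have := M.card_advUnion_le
    rw [Nat.card_Icc] at *
    lia
  have hcard : (b * M.ℓ : ℝ) ≤ #((Icc 1 (b * M.ℓ) \ M.advUnion) ∩ M.ro) + M.Γ * M.ℓ := by
    exact_mod_cast hcard
  have hro : (M.ro.card : ℝ) ≤ M.n := by exact_mod_cast M.card_ro_le
  calc (b - M.Γ) * (M.ℓ / M.n : ℝ) = (b * M.ℓ - M.Γ * M.ℓ) / M.n := by ring
    _ ≤ #((Icc 1 (b * M.ℓ) \ M.advUnion) ∩ M.ro) / M.n := by gcongr; linarith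
    _ ≤ _ := div_le_div_of_nonneg_left (Nat.cast_nonneg _)
        (by linarith [M.n_pos, le_card_ro_sub_one hn]) (by linarith)

theorem exp_le_one_div_k_sq {x : ℝ} (hx : x ≤ -(2 * Real.log M.k)) :
    Real.exp x ≤ 1 / M.k ^ 2 := by
  refine (Real.exp_le_exp.2 hx).trans_eq ?_
  rw [Real.exp_neg, mul_comm, Real.exp_mul, Real.exp_log M.k_pos, Real.rpow_ofNat, one_div]

theorem pinnedLaw_real_window_overfull_le (ht : t ∈ M.ro) (i : Fin M.ro.card)
    (hn : 8 * M.ℓ * (M.Γ + 2) ≤ M.n) (hy : ∀ j, y j ∈ Set.Icc (0 : ℝ) 1)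
    (hY : ∑ j, y j ≤ M.k + 1) {b : ℕ} (hA : A ⊆ baroWindow M.ℓ b) (htA : t ∉ A) :
    (pinnedLaw ⟨t, ht⟩ i).real
      {σ : M.ArrivalOrder | 601 * M.share ≤ ∑ s ∈ A, M.itemLoad y σ s} ≤ 1 / M.k ^ 2 := by
  have hmean : M.roFraction A * ∑ j, y j ≤ 2 * M.share := by
    calc M.roFraction A * ∑ j, y j ≤ 8 / 7 * (M.ℓ / M.n) * (M.k + 1) := by
          gcongr
          · exact sum_nonneg fun j _ => (hy j).1
          · exact roFraction_window_le hn hA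
      _ ≤ 8 / 7 * (M.ℓ / M.n) * (7 / 4 * M.k) := by gcongr; linarith [M.k_ge]
      _ = 2 * M.share := by rw [share]; ring
  refine (pinnedLaw_real_le_sum_itemLoad_le (θ := 1) (κ := 2 * M.share) (lam := 599 * M.share) ht i
    htA hy (by simp) hmean (by linarith)).trans (exp_le_one_div_k_sq ?_)
  linarith [M.le_share, M.four_le_log_k]

theorem pinnedLaw_real_prefix_overfull_le (ht : t ∈ M.ro) (i : Fin M.ro.card)
    (hy : ∀ j, y j ∈ Set.Icc (0 : ℝ) 1) (hY : ∑ j, y j ≤ M.k + 1) {c δ : ℝ}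
    (hδ : δ ∈ Set.Icc (0 : ℝ) 1) (hc : M.k * (t / M.n) + M.Γ * M.share + 1 + M.k * δ ≤ c) :
    (pinnedLaw ⟨t, ht⟩ i).real
      {σ : M.ArrivalOrder | c ≤ ∑ s ∈ Ico 1 t, M.itemLoad y σ s} ≤
      Real.exp (-(M.k * δ ^ 2 / 8)) := by
  have hp0 : 0 ≤ M.roFraction (Ico 1 t) := roFraction_nonneg ht
  have hp1 : M.roFraction (Ico 1 t) ≤ 1 := roFraction_le_one ht (by simp)
  have hmean : M.roFraction (Ico 1 t) * ∑ j, y j ≤ M.k * (t / M.n) + M.Γ * M.share + 1 := by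
    calc M.roFraction (Ico 1 t) * ∑ j, y j ≤ M.roFraction (Ico 1 t) * (M.k + 1) := by gcongr
      _ ≤ M.roFraction (Ico 1 t) * M.k + 1 := by linarith
      _ ≤ (t / M.n + M.Γ * (M.ℓ / M.n)) * M.k + 1 := by
          gcongr
          exacts [M.k_pos.le, roFraction_Ico_le ht]
      _ = M.k * (t / M.n) + M.Γ * M.share + 1 := by rw [share]; ring
  have hmean' : M.roFraction (Ico 1 t) * ∑ j, y j ≤ M.k + 1 :=
    (mul_le_of_le_one_left (sum_nonneg fun j _ => (hy j).1) hp1).trans hY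
  refine (pinnedLaw_real_le_sum_itemLoad_le (θ := δ / 2) (lam := M.k * δ) ht i (by simp) hy
    ⟨by linarith [hδ.1], by linarith [hδ.2]⟩ hmean' (by linarith)).trans (Real.exp_le_exp.2 ?_)
  nlinarith [M.k_ge, sq_nonneg δ]

theorem underfull_exponent_le (M : BaroInstance) :
    (Real.log M.k / Real.sqrt M.k) ^ 2 * (M.k + 1) -
      Real.log M.k / Real.sqrt M.k * ((3 * M.Γ - 1) * M.share - 1) ≤ -(2 * Real.log M.k) := by
  set r := Real.sqrt M.k
  set L := Real.log M.k
  have hr : 8 ≤ r := M.eight_le_sqrt_k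
  have hL : 4 ≤ L := M.four_le_log_k
  have hk : M.k = r ^ 2 := (Real.sq_sqrt M.k_pos.le).symm
  have hlam : 7 / 4 * r * L ≤ (3 * M.Γ - 1) * M.share - 1 := by
    have hΓr : 2 * r * (7 / 8 * L) ≤ 2 * M.Γ * M.share := by
      gcongr
      exacts [M.Γ_ge, M.le_share]
    have hΓ : 1 ≤ (M.Γ - 1) * M.share := by
      nlinarith [M.eight_le_Γ, M.seven_halves_le_share]
    linarith
  have hquad : (L / r) ^ 2 * (M.k + 1) ≤ L ^ 2 + L ^ 2 / 64 := by
    rw [hk, show (L / r) ^ 2 * (r ^ 2 + 1) = L ^ 2 + L ^ 2 / r ^ 2 by field_simp]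
    gcongr
    nlinarith
  have hlin : 7 / 4 * L ^ 2 ≤ L / r * ((3 * M.Γ - 1) * M.share - 1) := by
    rw [show 7 / 4 * L ^ 2 = L / r * (7 / 4 * r * L) by field_simp]
    gcongr
  nlinarith

theorem pinnedLaw_real_free_underfull_le (ht : t ∈ M.ro) (i : Fin M.ro.card)
    (hn : 8 * M.ℓ * (M.Γ + 2) ≤ M.n) (hy : ∀ j, y j ∈ Set.Icc (0 : ℝ) 1)
    (hY : ∑ j, y j ∈ Set.Icc M.k (M.k + 1)) {b : ℕ} (hb : b * M.ℓ < t) :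
    (pinnedLaw ⟨t, ht⟩ i).real
      {σ : M.ArrivalOrder | ∑ s ∈ Icc 1 (b * M.ℓ) \ M.advUnion, M.itemLoad y σ s ≤
        (b + 1 - 4 * M.Γ) * M.share} ≤ 1 / M.k ^ 2 := by
  have htn : t ≤ M.n := (mem_Icc.1 (mem_sdiff.1 ht).1).2
  have hmean : (b - M.Γ) * M.share ≤
      M.roFraction (Icc 1 (b * M.ℓ) \ M.advUnion) * ∑ j, y j := by
    calc (b - M.Γ) * M.share = (b - M.Γ) * (M.ℓ / M.n) * M.k := by rw [share]; ring
      _ ≤ M.roFraction (Icc 1 (b * M.ℓ) \ M.advUnion) * M.k := by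
          gcongr
          exacts [M.k_pos.le, le_roFraction_free hn (by lia)]
      _ ≤ M.roFraction (Icc 1 (b * M.ℓ) \ M.advUnion) * ∑ j, y j := by
          gcongr
          exacts [roFraction_nonneg ht, hY.1]
  have hθ : Real.log M.k / Real.sqrt M.k ∈ Set.Icc (0 : ℝ) 1 :=
    ⟨div_nonneg (by linarith [M.four_le_log_k]) (Real.sqrt_nonneg _),
      div_le_one_of_le₀ M.log_k_le_sqrt_k (Real.sqrt_nonneg _)⟩
  refine (pinnedLaw_real_sum_itemLoad_le_le (lam := (3 * M.Γ - 1) * M.share - 1) ht i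
    (by simp; lia) hy hθ (by linarith)).trans
    (exp_le_one_div_k_sq (le_trans ?_ M.underfull_exponent_le))
  gcongr
  exact hY.2

end Tails

end BaroInstance

namespace BaroInstance

open Finset

/-- The item weights that keep the sizes of the items in `D` and discard all other items. -/
noncomputable def denseWeight (M : BaroInstance) (D : Finset (Fin M.ro.card))
    (j : Fin M.ro.card) : ℝ :=
  if j ∈ D then M.w j else 0

/-- An arrival order is typical at the window `b` before `t`, for a set `D` of items, if the window
does not receive too much weight of `D` before `t`, and if the free times of the windows before it
receive enough weight of `D` to exhaust the budgets of the linear programs of the window. The latter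
is not demanded if `D` contains all items. -/
structure TypicalAt (M : BaroInstance) (D : Finset (Fin M.ro.card)) (t b : ℕ)
    (σ : M.ArrivalOrder) : Prop where
  free_load : D ≠ univ → (b + 1 - 4 * M.Γ) * M.share <
    ∑ s ∈ Icc 1 (b * M.ℓ) \ M.advUnion, M.itemLoad (M.denseWeight D) σ s
  window_load :
    ∑ s ∈ baroWindow M.ℓ b ∩ Ico 1 t, M.itemLoad (M.denseWeight D) σ s < 601 * M.share

/-- An arrival order is typical before `t`, for a set `D` of items, if it is so at every window that
starts no later than `t`. -/
def Typical (M : BaroInstance) (D : Finset (Fin M.ro.card)) (t : ℕ) (σ : M.ArrivalOrder) : Prop :=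
  ∀ b, b * M.ℓ < t → M.TypicalAt D t b σ

open Classical in
/-- The free times in `[s]` at which an item of `D` arrives. -/
noncomputable def denseTimes (M : BaroInstance) (D : Finset (Fin M.ro.card)) (σ : M.ArrivalOrder)
    (s : ℕ) : Finset ℕ :=
  {r ∈ Icc 1 s | ∃ hr : M.IsFree r, σ ⟨r, hr.mem_ro⟩ ∈ D}

/-- The times at which an algorithm may pick items outside of a given set of dense items even in a
typical order: the first `4Γ` windows, where the linear program may be infeasible, and the
adversarial windows. -/
def uncontrolledTimes (M : BaroInstance) : Finset ℕ :=
  (range (4 * M.Γ) ∪ M.advWindows).biUnion (baroWindow M.ℓ)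

variable {M : BaroInstance} {D : Finset (Fin M.ro.card)} {σ : M.ArrivalOrder} {s t : ℕ}

theorem denseWeight_mem_Icc (M : BaroInstance) (D : Finset (Fin M.ro.card)) (j : Fin M.ro.card) :
    M.denseWeight D j ∈ Set.Icc (0 : ℝ) 1 := by
  rw [denseWeight]; split_ifs
  exacts [⟨(M.w_pos j).le, M.w_le_one j⟩, ⟨le_rfl, zero_le_one⟩]

theorem sum_denseWeight (M : BaroInstance) (D : Finset (Fin M.ro.card)) :
    ∑ j, M.denseWeight D j = ∑ j ∈ D, M.w j := by
  simp [denseWeight, sum_ite_mem]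

theorem itemLoad_denseWeight_nonneg (M : BaroInstance) (D : Finset (Fin M.ro.card))
    (σ : M.ArrivalOrder) (s : ℕ) : 0 ≤ M.itemLoad (M.denseWeight D) σ s :=
  itemLoad_nonneg (fun j => (M.denseWeight_mem_Icc D j).1) σ s

theorem mem_denseTimes :
    s ∈ M.denseTimes D σ t ↔ s ≤ t ∧ ∃ hs : M.IsFree s, σ ⟨s, hs.mem_ro⟩ ∈ D := by
  simp only [denseTimes, mem_filter, mem_Icc]
  exact ⟨fun h => ⟨h.1.2, h.2⟩, fun h => ⟨⟨(mem_Icc.1 h.2.1.1).1, h.1⟩, h.2⟩⟩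

theorem denseTimes_subset : M.denseTimes D σ t ⊆ Icc 1 t := fun _ hs =>
  have ⟨hst, hfree, _⟩ := mem_denseTimes.1 hs
  mem_Icc.2 ⟨(mem_Icc.1 hfree.1).1, hst⟩

theorem mem_uncontrolledTimes (M : BaroInstance) :
    s ∈ M.uncontrolledTimes ↔ ∃ b, (b < 4 * M.Γ ∨ b ∈ M.advWindows) ∧ s ∈ baroWindow M.ℓ b := by
  simp [uncontrolledTimes]

theorem card_uncontrolledWindows_le (M : BaroInstance) :
    #(range (4 * M.Γ) ∪ M.advWindows) ≤ 5 * M.Γ := by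
  have := card_union_le (range (4 * M.Γ)) M.advWindows
  have := M.advWindows_card
  rw [card_range] at *
  lia

theorem sum_uncontrolled_xalg_le (M : BaroInstance) {a₄ : ℝ} {W : ℕ → ℝ} (X : ℕ → ℕ → ℝ)
    (ha₄ : 0 ≤ a₄) (hW : ∀ t ∈ Icc 1 M.n, W t ≤ 1) (ht : t ≤ M.n) :
    ∑ s ∈ Icc 1 t ∩ M.uncontrolledTimes, W s * M.xalg a₄ W X s ≤
      5 * M.Γ * (a₄ * M.share) := by
  have hdisjoint : (range (4 * M.Γ) ∪ M.advWindows : Set ℕ).PairwiseDisjoint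
      fun b => Icc 1 t ∩ baroWindow M.ℓ b := by
    refine fun b _ b' _ hne => disjoint_left.2 fun s hs hs' => hne ?_
    rw [mem_inter] at hs hs'
    have hs1 := (mem_Icc.1 hs.1).1
    rw [← (mem_baroWindow_iff hs1 M.ℓ_pos).1 hs.2, (mem_baroWindow_iff hs1 M.ℓ_pos).1 hs'.2]
  rw [uncontrolledTimes, inter_biUnion, sum_biUnion (by simpa using hdisjoint)]
  calc _ ≤ #(range (4 * M.Γ) ∪ M.advWindows) • (a₄ * M.share) :=
        sum_le_card_nsmul _ _ _ fun b _ => by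
          rw [inter_comm]
          exact M.sum_window_xalg_le X ha₄ hW b ht
    _ ≤ 5 * M.Γ * (a₄ * M.share) := by
        rw [nsmul_eq_mul]
        gcongr
        · exact mul_nonneg ha₄ M.share_pos.le
        · exact_mod_cast M.card_uncontrolledWindows_le

theorem lpFeasible_zero {W : ℕ → ℝ} (hs : 4 * M.Γ * M.ℓ < s) : M.LPFeasible W s 0 := by
  have hscale : 0 ≤ M.scale s := by
    rw [scale, sub_nonneg]
    exact div_le_one_of_le₀ (by exact_mod_cast hs.le) (Nat.cast_nonneg s)
  have hk := M.k_pos.le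
  refine ⟨?_, fun b => ?_, fun r _ => ⟨le_rfl, zero_le_one⟩⟩ <;>
    · simp only [Pi.zero_apply, mul_zero, sum_const_zero]
      positivity

end BaroInstance

namespace BaroRun

open Finset

variable {M : BaroInstance} {Ω : Type*} [MeasurableSpace Ω] {P : MeasureTheory.Measure Ω}
  (S : BaroRun M P) {ω : Ω} {D : Finset (Fin M.ro.card)} {s t : ℕ} {a₄ : ℝ}

theorem W_pos (ω : Ω) (hs : s ∈ M.ro) : 0 < S.W ω s := by
  rw [S.W_ro ω ⟨s, hs⟩]
  exact M.w_pos _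

theorem density_eq (ω : Ω) (hs : s ∈ M.ro) :
    S.V ω s / S.W ω s = M.v (S.I ω ⟨s, hs⟩) / M.w (S.I ω ⟨s, hs⟩) := by
  rw [S.V_ro ω ⟨s, hs⟩, S.W_ro ω ⟨s, hs⟩]

theorem itemLoad_denseWeight_eq (hs : s ∈ M.ro) (hsD : S.I ω ⟨s, hs⟩ ∈ D) :
    M.itemLoad (M.denseWeight D) (S.I ω) s = S.W ω s := by
  rw [BaroInstance.itemLoad, dif_pos hs, BaroInstance.denseWeight, if_pos hsD, S.W_ro ω ⟨s, hs⟩]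

theorem sum_itemLoad_eq_sum_W {A : Finset ℕ} (hA : A ⊆ M.denseTimes D (S.I ω) s) :
    ∑ r ∈ A, M.itemLoad (M.denseWeight D) (S.I ω) r = ∑ r ∈ A, S.W ω r :=
  sum_congr rfl fun _ hr =>
    let ⟨_, hfree, hD⟩ := BaroInstance.mem_denseTimes.1 (hA hr)
    S.itemLoad_denseWeight_eq hfree.mem_ro hD

theorem sum_itemLoad_free_le {m : ℕ} (hm : m ≤ s) (hs : s ≤ M.n) :
    ∑ r ∈ Icc 1 m \ M.advUnion, M.itemLoad (M.denseWeight D) (S.I ω) r ≤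
      ∑ r ∈ M.denseTimes D (S.I ω) s, S.W ω r := by
  rw [← S.sum_itemLoad_eq_sum_W Subset.rfl, ← sum_filter_ne_zero]
  refine sum_le_sum_of_subset_of_nonneg (fun r hr => ?_) fun r _ _ =>
    M.itemLoad_denseWeight_nonneg D (S.I ω) r
  obtain ⟨hr, hload⟩ := mem_filter.1 hr
  obtain ⟨hrm, hradv⟩ := mem_sdiff.1 hr
  have hfree : M.IsFree r :=
    M.isFree_iff.2 ⟨Icc_subset_Icc_right (hm.trans hs) hrm, hradv⟩
  refine BaroInstance.mem_denseTimes.2 ⟨(mem_Icc.1 hrm).2.trans hm, hfree, ?_⟩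
  by_contra hrD
  simp [BaroInstance.itemLoad, BaroInstance.denseWeight, hrD] at hload

theorem budget_lt_sum_denseTimes (hT : M.Typical D t (S.I ω)) (hD : D ≠ univ)
    (hs : s ∈ Icc 1 M.n) (hst : s ≤ t) :
    M.scale s * (s / M.n) * M.k < ∑ u ∈ M.denseTimes D (S.I ω) s, S.W ω u := by
  obtain ⟨hs1, hsn⟩ := mem_Icc.1 hs
  obtain ⟨hbs, hsb⟩ := mem_Icc.1 (mem_baroWindow_div hs1 M.ℓ_pos)
  have hsb : (s : ℝ) / M.ℓ ≤ ((s - 1) / M.ℓ : ℕ) + 1 := by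
    rw [div_le_iff₀ (by exact_mod_cast M.ℓ_pos)]
    exact_mod_cast hsb
  rw [M.scale_mul_eq (by lia)]
  calc (s / M.ℓ - 4 * M.Γ) * M.share ≤ (((s - 1) / M.ℓ : ℕ) + 1 - 4 * M.Γ) * M.share := by
        gcongr
        exact M.share_pos.le
    _ < _ := (hT _ (by lia)).free_load hD
    _ ≤ _ := S.sum_itemLoad_free_le (by lia) hsn

theorem sum_window_denseTimes_lt (hT : M.Typical D t (S.I ω)) (hst : s < t) (b : ℕ) :
    ∑ r ∈ (baroWindow M.ℓ b ∩ Icc 1 s) ∩ M.denseTimes D (S.I ω) s, S.W ω r < 601 * M.share := by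
  by_cases hb : b * M.ℓ < t
  · rw [← S.sum_itemLoad_eq_sum_W inter_subset_right]
    refine (sum_le_sum_of_subset_of_nonneg (fun r hr => ?_) fun r _ _ =>
      M.itemLoad_denseWeight_nonneg D (S.I ω) r).trans_lt (hT b hb).window_load
    simp only [mem_inter, mem_Icc, mem_Ico] at hr ⊢
    lia
  · have hempty : baroWindow M.ℓ b ∩ Icc 1 s = ∅ := by
      ext r
      simp only [baroWindow, mem_inter, mem_Icc, notMem_empty]
      lia
    rw [hempty, empty_inter, sum_empty]
    linarith [M.share_pos]

theorem mem_of_tentatively_picked (hD : ∀ i ∈ D, ∀ j ∉ D, M.v j / M.w j < M.v i / M.w i)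
    (hT : M.Typical D t (S.I ω)) (hs : M.IsFree s) (hst : s < t) (hsΓ : 4 * M.Γ * M.ℓ < s)
    (hX : 0 < S.X ω s s) : S.I ω ⟨s, hs.mem_ro⟩ ∈ D := by
  obtain ⟨hs1, hsn⟩ := mem_Icc.1 hs.1
  by_contra hsD
  have hless_dense {u r : ℕ} (hu : u ∈ M.denseTimes D (S.I ω) s) (hr : M.IsFree r) (hrs : r ≤ s)
      (hrF : r ∉ M.denseTimes D (S.I ω) s) :
      0 < S.W ω r ∧ S.V ω r / S.W ω r < S.V ω u / S.W ω u := by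
    obtain ⟨-, hu, huD⟩ := BaroInstance.mem_denseTimes.1 hu
    refine ⟨S.W_pos ω hr.mem_ro, ?_⟩
    rw [S.density_eq ω hr.mem_ro, S.density_eq ω hu.mem_ro]
    exact hD _ huD _ fun hrD => hrF (BaroInstance.mem_denseTimes.2 ⟨hrs, hr, hrD⟩)
  have hsF : s ∉ M.denseTimes D (S.I ω) s := fun h => hsD (BaroInstance.mem_denseTimes.1 h).2.2
  refine hX.not_ge <| (S.X_optimal ω s hs.1
    ⟨0, BaroInstance.lpFeasible_zero hsΓ⟩).nonpos_of_dense hs1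
      (fun u hu => (S.W_mem ω u (Icc_subset_Icc_right hsn hu)).1) BaroInstance.denseTimes_subset hsF
      (fun u hu => S.W_pos ω (BaroInstance.mem_denseTimes.1 hu).2.1.mem_ro)
      (S.budget_lt_sum_denseTimes hT (fun h => hsD (h ▸ mem_univ _)) hs.1 hst.le)
      (S.sum_window_denseTimes_lt hT hst) fun u hu b hub r hr hrF => ?_
  obtain rfl | hr := mem_insert.1 hr
  · exact hless_dense hu hs le_rfl hrF
  · obtain ⟨hrb, hrs⟩ := mem_inter.1 hr
    exact hless_dense hu ((BaroInstance.mem_denseTimes.1 hu).2.1.of_mem_baroWindow hub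
      (Icc_subset_Icc_right hsn hrs) hrb) (mem_Icc.1 hrs).2 hrF

theorem size_mul_xalg_le_itemLoad (hD : ∀ i ∈ D, ∀ j ∉ D, M.v j / M.w j < M.v i / M.w i)
    (hT : M.Typical D t (S.I ω)) (hs : M.IsFree s) (hst : s < t) (hsΓ : 4 * M.Γ * M.ℓ < s) :
    S.W ω s * M.xalg a₄ (S.W ω) (S.X ω) s ≤ M.itemLoad (M.denseWeight D) (S.I ω) s := by
  rw [M.xalg_eq _ _ _ (mem_Icc.1 hs.1).1]
  split_ifs with hpicked
  · rw [mul_one, S.itemLoad_denseWeight_eq hs.mem_ro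
      (S.mem_of_tentatively_picked hD hT hs hst hsΓ hpicked.1)]
  · rw [mul_zero]
    exact M.itemLoad_denseWeight_nonneg D (S.I ω) s

theorem sum_baroLast_le (hD : ∀ i ∈ D, ∀ j ∉ D, M.v j / M.w j < M.v i / M.w i)
    (hT : M.Typical D t (S.I ω)) (ht : M.IsFree t) (h8 : 8 * M.ℓ * (M.Γ + 2) ≤ t) :
    ∑ s ∈ baroLast M.ℓ t, S.W ω s * M.xalg a₄ (S.W ω) (S.X ω) s ≤ 601 * M.share := by
  obtain ⟨ht1, htn⟩ := mem_Icc.1 ht.1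
  have htb := mem_baroWindow_div ht1 M.ℓ_pos
  obtain ⟨hbt, htb'⟩ := mem_Icc.1 htb
  rw [baroLast_eq ht1 M.ℓ_pos]
  refine le_trans (sum_le_sum fun s hs => ?_) (hT ((t - 1) / M.ℓ) (by lia)).window_load.le
  obtain ⟨hsb, hst⟩ := mem_inter.1 hs
  obtain ⟨hs1, hst⟩ := mem_Ico.1 hst
  refine S.size_mul_xalg_le_itemLoad hD hT
    (ht.of_mem_baroWindow htb (mem_Icc.2 ⟨hs1, by lia⟩) hsb) hst ?_
  rw [add_mul, one_mul] at htb'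
  nlinarith [(mem_Icc.1 hsb).1]

theorem sum_controlled_xalg_le (hD : ∀ i ∈ D, ∀ j ∉ D, M.v j / M.w j < M.v i / M.w i)
    (hT : M.Typical D t (S.I ω)) (htn : t ≤ M.n) :
    ∑ s ∈ Ico 1 t \ M.uncontrolledTimes, S.W ω s * M.xalg a₄ (S.W ω) (S.X ω) s ≤
      ∑ s ∈ Ico 1 t, M.itemLoad (M.denseWeight D) (S.I ω) s := by
  refine le_trans (sum_le_sum fun s hs => ?_) (sum_le_sum_of_subset_of_nonneg sdiff_subset
    fun s _ _ => M.itemLoad_denseWeight_nonneg D (S.I ω) s)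
  obtain ⟨hst, hs⟩ := mem_sdiff.1 hs
  obtain ⟨hs1, hst⟩ := mem_Ico.1 hst
  rw [M.mem_uncontrolledTimes] at hs
  push Not at hs
  refine S.size_mul_xalg_le_itemLoad hD hT
    ⟨mem_Icc.2 ⟨hs1, by lia⟩, fun b hb => hs b (.inr hb)⟩ hst ?_
  by_contra! hle
  refine hs _ (.inl ?_) (mem_baroWindow_div hs1 M.ℓ_pos)
  rw [Nat.div_lt_iff_lt_mul M.ℓ_pos]
  lia

theorem unblocked_of_typical (ha₄ : 700 ≤ a₄)
    (hD : ∀ i ∈ D, ∀ j ∉ D, M.v j / M.w j < M.v i / M.w i)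
    (hT : M.Typical D t (S.I ω)) (ht : M.IsFree t) (h8 : 8 * M.ℓ * (M.Γ + 2) ≤ t)
    (hload : ∑ s ∈ Ico 1 t, M.itemLoad (M.denseWeight D) (S.I ω) s <
      M.k - 1 - 5 * M.Γ * (a₄ * M.share)) :
    M.Unblocked a₄ (S.W ω) (M.xalg a₄ (S.W ω) (S.X ω)) t := by
  obtain ⟨ht1, htn⟩ := mem_Icc.1 ht.1
  constructor
  · have hlast := S.sum_baroLast_le (a₄ := a₄) hD hT ht h8
    rw [mul_assoc, ← BaroInstance.share]
    nlinarith [M.seven_halves_le_share]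
  · have huncontrolled := M.sum_uncontrolled_xalg_le (a₄ := a₄) (t := t - 1) (S.X ω)
      (by linarith) (fun s hs => (S.W_mem ω s hs).2) (by lia)
    have hcontrolled := S.sum_controlled_xalg_le (a₄ := a₄) hD hT htn
    rw [Icc_sub_one_right_eq_Ico_of_not_isMin (by simp; lia)] at huncontrolled
    rw [← sum_inter_add_sum_sdiff (Ico 1 t) M.uncontrolledTimes]
    linarith

end BaroRun

namespace BaroInstance

open MeasureTheory Finset

variable {M : BaroInstance} {D : Finset (Fin M.ro.card)} {t : ℕ}

theorem pinnedLaw_real_not_typicalAt_le (ht : t ∈ M.ro) (i : Fin M.ro.card)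
    (hn : 8 * M.ℓ * (M.Γ + 2) ≤ M.n) (hD_le : ∑ j ∈ D, M.w j ≤ M.k + 1)
    (hD_ge : D = univ ∨ M.k ≤ ∑ j ∈ D, M.w j) {b : ℕ} (hb : b * M.ℓ < t) :
    (pinnedLaw ⟨t, ht⟩ i).real {σ : M.ArrivalOrder | ¬ M.TypicalAt D t b σ} ≤ 2 / M.k ^ 2 := by
  rw [← sum_denseWeight] at hD_le hD_ge
  have hy := M.denseWeight_mem_Icc D
  let underfull : Set M.ArrivalOrder :=
    {σ | D ≠ univ ∧ ∑ s ∈ Icc 1 (b * M.ℓ) \ M.advUnion, M.itemLoad (M.denseWeight D) σ s ≤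
      (b + 1 - 4 * M.Γ) * M.share}
  let overfull : Set M.ArrivalOrder :=
    {σ | 601 * M.share ≤ ∑ s ∈ baroWindow M.ℓ b ∩ Ico 1 t, M.itemLoad (M.denseWeight D) σ s}
  have hunderfull : (pinnedLaw ⟨t, ht⟩ i).real underfull ≤ 1 / M.k ^ 2 := by
    by_cases hD : D = univ
    · simpa [underfull, hD] using sq_nonneg M.k
    · simpa only [underfull, ne_eq, hD, not_false_eq_true, true_and] using
        pinnedLaw_real_free_underfull_le ht i hn hy ⟨hD_ge.resolve_left hD, hD_le⟩ hb
  have hoverfull : (pinnedLaw ⟨t, ht⟩ i).real overfull ≤ 1 / M.k ^ 2 :=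
    pinnedLaw_real_window_overfull_le ht i hn hy hD_le inter_subset_left (by simp)
  calc (pinnedLaw ⟨t, ht⟩ i).real {σ : M.ArrivalOrder | ¬ M.TypicalAt D t b σ}
      ≤ (pinnedLaw ⟨t, ht⟩ i).real (underfull ∪ overfull) := by
        refine measureReal_mono (fun σ hσ => ?_) (measure_ne_top _ _)
        by_contra h
        simp only [underfull, overfull, Set.mem_union, Set.mem_ofPred_eq, not_or, not_and,
          not_le] at h
        exact hσ ⟨h.1, h.2⟩
    _ ≤ 1 / M.k ^ 2 + 1 / M.k ^ 2 :=
        (measureReal_union_le _ _).trans (add_le_add hunderfull hoverfull)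
    _ = 2 / M.k ^ 2 := by ring

theorem pinnedLaw_real_not_typical_le (ht : t ∈ M.ro) (i : Fin M.ro.card)
    (hn : 8 * M.ℓ * (M.Γ + 2) ≤ M.n) (hD_le : ∑ j ∈ D, M.w j ≤ M.k + 1)
    (hD_ge : D = univ ∨ M.k ≤ ∑ j ∈ D, M.w j) :
    (pinnedLaw ⟨t, ht⟩ i).real {σ : M.ArrivalOrder | ¬ M.Typical D t σ} ≤ 2 / M.k := by
  obtain ⟨ht1, htn⟩ := mem_Icc.1 (mem_sdiff.1 ht).1
  have hmem_range (b : ℕ) : b ∈ range ((t - 1) / M.ℓ + 1) ↔ b * M.ℓ < t := by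
    rw [mem_range, Nat.lt_succ_iff, Nat.le_div_iff_mul_le M.ℓ_pos]
    lia
  have hunion : {σ : M.ArrivalOrder | ¬ M.Typical D t σ} =
      ⋃ b ∈ range ((t - 1) / M.ℓ + 1), {σ | ¬ M.TypicalAt D t b σ} := by
    ext σ
    simp [Typical, hmem_range]
  calc (pinnedLaw ⟨t, ht⟩ i).real {σ : M.ArrivalOrder | ¬ M.Typical D t σ}
      ≤ ∑ b ∈ range ((t - 1) / M.ℓ + 1),
          (pinnedLaw ⟨t, ht⟩ i).real {σ : M.ArrivalOrder | ¬ M.TypicalAt D t b σ} :=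
        hunion ▸ measureReal_biUnion_finset_le _ _
    _ ≤ #(range ((t - 1) / M.ℓ + 1)) • (2 / M.k ^ 2) :=
        sum_le_card_nsmul _ _ _ fun b hb =>
          pinnedLaw_real_not_typicalAt_le ht i hn hD_le hD_ge ((hmem_range b).1 hb)
    _ ≤ M.k * (2 / M.k ^ 2) := by
        rw [card_range, nsmul_eq_mul]
        gcongr
        refine le_trans ?_ M.card_windows_le
        gcongr
        lia
    _ = 2 / M.k := by
        have := M.k_pos.ne'
        field_simp

end BaroInstance

namespace BaroRun

open MeasureTheory ProbabilityTheory Finset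

variable {M : BaroInstance} {Ω : Type*} [MeasurableSpace Ω] {P : Measure Ω}
  (S : BaroRun M P)

theorem measurableSet_I_mem (A : Finset M.ArrivalOrder) : MeasurableSet {ω | S.I ω ∈ A} := by
  have hunion : {ω | S.I ω ∈ A} = ⋃ σ ∈ A, {ω | S.I ω = σ} := by ext; simp
  exact hunion ▸ measurableSet_biUnion A fun σ _ => S.I_measurable σ

variable [IsFiniteMeasure P]

theorem real_I_mem (A : Finset M.ArrivalOrder) :
    P.real {ω | S.I ω ∈ A} = #A / (M.ro.card).factorial := by
  have hunion : {ω | S.I ω ∈ A} = ⋃ σ ∈ A, {ω | S.I ω = σ} := by ext; simp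
  rw [hunion, measureReal_biUnion_finset (fun σ _ τ _ hne => Set.disjoint_left.2
    fun ω hσ hτ => hne (hσ.symm.trans hτ)) fun σ _ => S.I_measurable σ]
  simp [S.I_uniform, div_eq_mul_inv]

theorem cond_real_le_pinnedLaw_real (a : M.ro) (i : Fin M.ro.card) {E : Set Ω}
    {B : Set M.ArrivalOrder} (hE : ∀ ω ∈ E, S.I ω a = i → S.I ω ∈ B) :
    (cond P {ω | S.I ω a = i}).real E ≤ (pinnedLaw a i).real B := by
  classical
  let pinned : Finset M.ArrivalOrder := {σ | σ a = i}
  have hpinned : {ω | S.I ω a = i} = {ω | S.I ω ∈ pinned} := by ext; simp [pinned]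
  have hlaw : (pinnedLaw a i).real B = #(pinned ∩ B.toFinset) / #pinned := by
    have hcoe : {σ : M.ArrivalOrder | σ a = i} = pinned := by ext; simp [pinned]
    rw [pinnedLaw, hcoe, ← Set.coe_toFinset B, measureReal_def, uniformOn_apply_finset]
    simp
  rw [hlaw, hpinned, measureReal_def,
    cond_apply (S.measurableSet_I_mem pinned), ENNReal.toReal_mul, ENNReal.toReal_inv,
    ← measureReal_def, ← measureReal_def, inv_mul_eq_div]
  calc P.real ({ω | S.I ω ∈ pinned} ∩ E) / P.real {ω | S.I ω ∈ pinned}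
      ≤ P.real {ω | S.I ω ∈ pinned ∩ B.toFinset} / P.real {ω | S.I ω ∈ pinned} := by
        gcongr
        · exact measure_ne_top _ _
        · intro ω hω
          have := hE ω hω.2 (by simpa [pinned] using hω.1)
          simpa [this] using hω.1
    _ = #(pinned ∩ B.toFinset) / #pinned := by
        rw [S.real_I_mem, S.real_I_mem, div_div_div_cancel_right₀ (by positivity)]

theorem cond_real_blocked_le {a₄ : ℝ} (ha₄ : 700 ≤ a₄) {t : ℕ} (ht : M.IsFree t)
    (h8 : 8 * M.ℓ * (M.Γ + 2) ≤ t) (i : Fin M.ro.card) {δ : ℝ} (hδ : δ ∈ Set.Icc (0 : ℝ) 1)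
    (hc : M.k * (t / M.n) + (5 * a₄ + 1) * (M.Γ * M.share) + 2 + M.k * δ ≤ M.k) :
    (cond P {ω | S.I ω ⟨t, ht.mem_ro⟩ = i}).real (S.blocked a₄ t) ≤
      2 / M.k + Real.exp (-(M.k * δ ^ 2 / 8)) := by
  obtain ⟨D, hD, hD_le, hD_ge⟩ :=
    exists_upper_finset_sum_near M.density_injective M.w_le_one M.k_pos.le
  calc (cond P {ω | S.I ω ⟨t, ht.mem_ro⟩ = i}).real (S.blocked a₄ t)
      ≤ (pinnedLaw ⟨t, ht.mem_ro⟩ i).real ({σ : M.ArrivalOrder | ¬ M.Typical D t σ} ∪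
          {σ | M.k - 1 - 5 * M.Γ * (a₄ * M.share) ≤
            ∑ s ∈ Ico 1 t, M.itemLoad (M.denseWeight D) σ s}) := by
        refine S.cond_real_le_pinnedLaw_real _ i fun ω hblocked _ => ?_
        by_contra hω
        rw [Set.mem_union, not_or, Set.mem_ofPred, Set.mem_ofPred, not_not, not_le] at hω
        exact hblocked (S.unblocked_of_typical ha₄ hD hω.1 ht h8 hω.2)
    _ ≤ _ := (measureReal_union_le _ _).trans <| add_le_add
        (BaroInstance.pinnedLaw_real_not_typical_le ht.mem_ro i (h8.trans (mem_Icc.1 ht.1).2)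
          hD_le hD_ge)
        (BaroInstance.pinnedLaw_real_prefix_overfull_le ht.mem_ro i (M.denseWeight_mem_Icc D)
          ((M.sum_denseWeight D).trans_le hD_le) hδ (by linarith))

end BaroRun

theorem BaroInstance.two_div_k_add_exp_le (M : BaroInstance) {δ : ℝ} (hδ : δ ∈ Set.Ioc (0 : ℝ) 1) :
    2 / M.k + Real.exp (-(M.k * δ ^ 2 / 8)) ≤ 10 / (M.k * δ ^ 2) := by
  have hk := M.k_pos
  have hx : 0 < M.k * δ ^ 2 := mul_pos hk (pow_pos hδ.1 2)
  have hexp : Real.exp (-(M.k * δ ^ 2 / 8)) ≤ 8 / (M.k * δ ^ 2) := by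
    rw [Real.exp_neg, inv_le_comm₀ (Real.exp_pos _) (by positivity), inv_div]
    linarith [Real.add_one_le_exp (M.k * δ ^ 2 / 8)]
  have htwo : 2 / M.k ≤ 2 / (M.k * δ ^ 2) := by
    gcongr
    exact mul_le_of_le_one_right hk.le (pow_le_one₀ hδ.1.le hδ.2)
  calc 2 / M.k + Real.exp (-(M.k * δ ^ 2 / 8)) ≤ 2 / (M.k * δ ^ 2) + 8 / (M.k * δ ^ 2) := by gcongr
    _ = 10 / (M.k * δ ^ 2) := by ring

theorem mainTheorem3 :
    ∃ A₄ : ℝ, 0 < A₄ ∧ ∀ a₄ : ℝ, A₄ ≤ a₄ → ∃ a₅ C : ℝ, 0 < a₅ ∧ 0 < C ∧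
      ∀ (M : BaroInstance) {Ω : Type*} [MeasurableSpace Ω] (P : MeasureTheory.Measure Ω)
        [MeasureTheory.IsProbabilityMeasure P] (S : BaroRun M P)
        (t : ℕ) (ht : M.IsFree t),
        8 * M.ℓ * (M.Γ + 2) ≤ t →
        0 < 1 - (t : ℝ) / M.n - a₅ * (M.Γ * Real.log M.k / M.k) →
        ∀ i : Fin M.ro.card,
          (ProbabilityTheory.cond P {ω | S.I ω ⟨t, ht.mem_ro⟩ = i}).real (S.blocked a₄ t) ≤
            C / (M.k * (1 - (t : ℝ) / M.n - a₅ * (M.Γ * Real.log M.k / M.k)) ^ 2) := by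
  refine ⟨700, by norm_num, fun a₄ ha₄ => ⟨6 * a₄ + 5, 10, by linarith, by norm_num, ?_⟩⟩
  intro M Ω _ P _ S t ht h8 hδ i
  have hk := M.k_pos
  have hΓlog : 32 ≤ M.Γ * Real.log M.k := by nlinarith [M.eight_le_Γ, M.four_le_log_k]
  have hδ1 : 1 - (t : ℝ) / M.n - (6 * a₄ + 5) * (M.Γ * Real.log M.k / M.k) ≤ 1 := by
    have : 0 ≤ (6 * a₄ + 5) * (M.Γ * Real.log M.k / M.k) :=
      mul_nonneg (by linarith) (div_nonneg (by linarith) hk.le)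
    linarith [show 0 ≤ (t : ℝ) / M.n by positivity]
  refine (S.cond_real_blocked_le ha₄ ht h8 i ⟨hδ.le, hδ1⟩ ?_).trans
    (M.two_div_k_add_exp_le ⟨hδ, hδ1⟩)
  have hshare : (5 * a₄ + 1) * (M.Γ * M.share) ≤
      (5 * a₄ + 1) * (M.Γ * (9 / 8 * Real.log M.k)) := by
    gcongr
    exact M.share_le
  have hlog_cancel : M.k * (M.Γ * Real.log M.k / M.k) = M.Γ * Real.log M.k := by field_simp
  nlinarith
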